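/- **Network.** A tree network has finitely many servers; every server $j$ has one successor $\mathrm{su}(j)$, except a unique sink, whose successor is the outside $o$, and every server leads to the sink. Put $d(o)=0$ and $d(j)=d(\mathrm{su}(j))+1$. Each flow $i$ of a finite set follows a non-empty path $\pi_i$ of consecutive servers, from a first server $f_i$ to a last server; $e_i$ is the successor of the last one. $\mathrm{Fl}(j)$ is the set of flows crossing $j$. Flow $i$ has the arrival curve $\alpha_i=\gamma_{b_i,r_i}$, where $\gamma_{b,r}(0)=0$ and $\gamma_{b,r}(t)=b+rt$ for $t>0$; server $j$ offers the service curve $\beta_j(t)=R_j(t-T_j)_+$ and has the greedy shaper $\sigma_j=\gamma_{L_j,C_j}$. All parameters are non-negative reals, $\beta_j\le\sigma_j$, and $\sum_{i\in \mathrm{Fl}(j)}r_i\le R_j$ (local stability) for every $j$. **Admissible trajectories.** A trajectory gives non-decreasing, left-continuous processes $F_i^{(j)}:\mathbb R_+\to\mathbb R_+$, null at $0$, for every flow $i$ and every $j\in\pi_i\cup\{e_i\}$. Write $A_j=\sum_{i\in \mathrm{Fl}(j)}F_i^{(j)}$ and $D_j=\sum_{i\in \mathrm{Fl}(j)}F_i^{(\mathrm{su}(j))}$.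 It is admissible if * $F_i^{(f_i)}(t)-F_i^{(f_i)}(s)\le\alpha_i(t-s)$ for $s\le t$, and $F_i^{(\mathrm{su}(j))}\le F_i^{(j)}$ for $j\in\pi_i$; * for every server $j$ there is a non-decreasing, left-continuous process $B$, null at $0$, with $A_j\ge B\ge A_j*\beta_j$ and $D_j=B*\sigma_j$, where $(f*g)(t)=\inf_{0\le s\le t}(f(s)+g(t-s))$; * (FIFO) the data arriving at each server are totally ordered compatibly with their arrival dates and are served in this order; data going from $j$ to $\mathrm{su}(j)$ arrive there in the order in which they left $j$, even if they left at the same date. Formally, there are functions $Q_{j,i}$, for $j$ a server and $i\in \mathrm{Fl}(j)$ ($Q_{j,i}(x)$ is the amount of flow $i$ among the first $x$ units arriving at $j$), such that: $Q_{j,i}$ is non-decreasing and $\sum_{i\in\mathrm{Fl}(j)}Q_{j,i}(x)=x$ on $\{x\ge 0 : x\le A_j(t)\text{ for some }t\}$; $F_i^{(j)}=Q_{j,i}\circ A_j$ and $F_i^{(\mathrm{su}(j))}=Q_{j,i}\circ D_j$; and if $h=\mathrm{su}(j)$ is a server, then for every $x\ge0$ bounded by a value of $A_h$ there is $y\ge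 0$ bounded by a value of $D_j$ with $Q_{h,i}(x)=Q_{j,i}(y)$ for all $i\in \mathrm{Fl}(j)\cap \mathrm{Fl}(h)$. For a flow $i$ ending at the sink, the worst-case delay is $\sup\{\delta : 0\le \delta\le t,\ F_i^{(f_i)}(t-\delta)>F_i^{(o)}(t)\}$ and the worst-case backlog is $\sup\,(F_i^{(f_i)}(t)-F_i^{(o)}(t))$, both over all admissible trajectories and all $t\ge0$ (the supremum of the empty set being $0$). **TFA++ and SFA bounds.** For $\alpha,\beta:\mathbb R_+\to[0,\infty]$ let $d_{\max}(\alpha,\beta)=\sup\{\delta\ge 0: \exists u\ge 0,\ \alpha(u)>\beta(u+\delta)\}$. TFA++ computes, in topological order and starting from $b_i^{(f_i)}=b_i$, $$d_j^{TFA}=d_{\max}\Big(\sum_{h:\,\mathrm{su}(h)=j}\min\big(\sigma_h,\sum_{i\in \mathrm{Fl}(h)\cap \mathrm{Fl}(j)}\gamma_{b_i^{(j)},r_i}\big)+\sum_{i:\,f_i=j}\alpha_i,\ \beta_j\Big),\qquad b_i^{(\mathrm{su}(j))}=b_i^{(j)}+r_id_j^{TFA}.$$ SFA computes, in topological order and starting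 from $c_i^{(f_i)}=b_i$, $$T_i^{(j)}=T_j+\frac1{R_j}\sum_{k\in \mathrm{Fl}(j)\setminus\{i\}}c_k^{(j)},\quad c_i^{(\mathrm{su}(j))}=c_i^{(j)}+r_iT_i^{(j)},\quad R_i^{(j)}=R_j-\sum_{k\in \mathrm{Fl}(j)\setminus\{i\}}r_k,\quad d_i^{SFA}=\sum_{j\in\pi_i}T_i^{(j)}+\frac{b_i}{\min_{j\in\pi_i}R_i^{(j)}},$$ with values in $[0,\infty]$ and the conventions $x/0=\infty$ for $x>0$, $0/0=0$, $0\cdot\infty=0$. **Linear program.** The real variables are dates $t_{v,k}$, for $v$ a server or $v=o$ and $0\le k\le d(v)$, and values $X_{i,v,k}$ (the process of flow $i$ at $v$ and date $t_{v,k}$), for $v\in\pi_i\cup\{e_i\}$ and $0\le k\le d(v)$. The constraints are, for all servers $j$, with $h=\mathrm{su}(j)$, and all flows $i$: * time: $t_{j,k+1}\le t_{j,k}$ for $k<d(j)$, and $t_{j,k}\le t_{h,k}$ for $k\le d(h)$; * FIFO: $X_{i,j,k}=X_{i,h,k}$ for $i\in \mathrm{Fl}(j)$, $k\le d(h)$;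 * service: $\sum_{i\in \mathrm{Fl}(j)}X_{i,h,d(h)}\ge\sum_{i\in \mathrm{Fl}(j)}X_{i,j,d(j)}+\max\big(0,\;R_j(t_{h,d(h)}-t_{j,d(j)})-R_jT_j\big)$ (two linear constraints); * arrival: $X_{i,f_i,u}-X_{i,f_i,v}\le b_i+r_i(t_{f_i,u}-t_{f_i,v})$ for $u<v\le d(f_i)$; * monotony: $X_{i,f_i,k+1}\le X_{i,f_i,k}$ for $k<d(f_i)$; together with the additional constraints * TFA++: $t_{h,k}-t_{j,k}\le d_j^{TFA}$ for $k\le d(h)$; * SFA: $t_{e_i,k}-t_{f_i,k}\le d_i^{SFA}$ for $k\le d(e_i)$; * shaping: $\sum_{i\in \mathrm{Fl}(j)}(X_{i,h,u}-X_{i,h,v})\le L_j+C_j(t_{h,u}-t_{h,v})$ for $u<v\le d(h)$. For the flow of interest $i$, which ends at the sink, the delay objective is to maximize $t_{o,0}-t_{f_i,0}$. For the backlog, one adds a variable $z$ (the process $F_i^{(f_i)}$ at date $t_{o,0}$) and the constraints $z-X_{i,f_i,u}\le b_i+r_i(t_{o,0}-t_{f_i,u})$ for $u\le d(f_i)$,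 and maximizes $z-X_{i,o,0}$. **Theorem.** For every flow of interest ending at the sink, the optimal value (in $[-\infty,\infty]$) of the linear program with all the additional constraints and the delay objective is at least the worst-case delay of that flow, and the one with the backlog constraints and objective is at least its worst-case backlog. -/

import Mathlib

open scoped NNReal ENNReal

/-! ### Cumulative processes and curves -/

namespace NetCalc

/-- Cumulative processes: non-decreasing, left-continuous, null at zero. -/
structure IsCumulative (A : ℝ≥0 → ℝ≥0) : Prop where
  mono : Monotone A
  leftCont : ∀ t, ContinuousWithinAt A (Set.Iic t) t
  zero : A 0 = 0

/-- `A` is `α`-constrained: `A t - A s ≤ α (t - s)` for all `s ≤ t`. -/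
def Constrained (A : ℝ≥0 → ℝ≥0) (α : ℝ≥0 → ℝ≥0∞) : Prop :=
  ∀ s t, s ≤ t → (A t : ℝ≥0∞) ≤ A s + α (t - s)

/-- Token bucket `γ_{b,r}`: `0 ↦ 0` and `t ↦ b + r t` for `t > 0`. -/
noncomputable def tokenBucket (b : ℝ≥0∞) (r : ℝ≥0) (t : ℝ≥0) : ℝ≥0∞ :=
  if t = 0 then 0 else b + r * t

/-- Rate-latency curve `β_{R,T} : t ↦ R (t - T)₊` (subtraction in `ℝ≥0` is the positive part). -/
noncomputable def rateLatency (R T : ℝ≥0) (t : ℝ≥0) : ℝ≥0∞ := ((R * (t - T) : ℝ≥0) : ℝ≥0∞)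

/-- (min,plus) convolution `inf_{0 ≤ s ≤ t} A s + f (t - s)`. -/
noncomputable def conv (A : ℝ≥0 → ℝ≥0) (f : ℝ≥0 → ℝ≥0∞) (t : ℝ≥0) : ℝ≥0∞ :=
  ⨅ s ∈ Set.Iic t, ((A s : ℝ≥0∞) + f (t - s))

/-- Maximal horizontal distance between an arrival curve and a service curve:
the supremum of the `d ≥ 0` with `α u > β (u + d)` for some `u`. -/
noncomputable def maxDelay (α β : ℝ≥0 → ℝ≥0∞) : ℝ≥0∞ :=
  ⨆ (u : ℝ≥0) (d : ℝ≥0) (_ : β (u + d) < α u), (d : ℝ≥0∞)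

/-- Worst delay between an arrival process `A` and a departure process `D`: the supremum over `t` of
`d(t) = sup {d ≥ 0 | A (t - d) > D t}`. -/
noncomputable def delay (A D : ℝ≥0 → ℝ≥0) : ℝ≥0∞ :=
  ⨆ (t : ℝ≥0) (d : ℝ≥0) (_ : d ≤ t ∧ D t < A (t - d)), (d : ℝ≥0∞)

/-- Worst backlog `sup_t (A t - D t)` between an arrival process and a departure process. -/
noncomputable def backlog (A D : ℝ≥0 → ℝ≥0) : ℝ≥0∞ := ⨆ t : ℝ≥0, ((A t - D t : ℝ≥0) : ℝ≥0∞)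

end NetCalc

/-! ### Tree networks -/

/-- A tree network with servers `S` and flows `ι`. A node is an element of `Option S`: a server, or
`none`, the outside of the network (numbered `n + 1` when the servers are `1, …, n`). -/
structure TreeNetwork (S ι : Type*) where
  /-- successor of a server -/
  su : S → Option S
  /-- the unique sink -/
  sink : S
  su_eq_none : ∀ j, su j = none ↔ j = sink
  reaches : ∀ v : Option S, ∃ k : ℕ, (fun w : Option S => w.bind su)^[k] v = none
  /-- path of a flow -/
  path : ι → List S
  path_ne_nil : ∀ i, path i ≠ []
  path_chain : ∀ i, (path i).IsChain (fun j h => su j = some h)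
  /-- burst of a flow -/
  b : ι → ℝ≥0
  /-- arrival rate of a flow -/
  r : ι → ℝ≥0
  /-- service rate of a server -/
  R : S → ℝ≥0
  /-- latency of a server -/
  T : S → ℝ≥0
  /-- burst of the greedy shaper of a server -/
  L : S → ℝ≥0
  /-- rate (link capacity) of the greedy shaper of a server -/
  C : S → ℝ≥0

namespace TreeNetwork

open NetCalc

variable {S ι : Type*} (N : TreeNetwork S ι)

/-- Arrival curve of a flow at its first server. -/
noncomputable def arrivalCurve (i : ι) : ℝ≥0 → ℝ≥0∞ := tokenBucket (N.b i) (N.r i)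

/-- Service curve of a server. -/
noncomputable def serviceCurve (j : S) : ℝ≥0 → ℝ≥0∞ := rateLatency (N.R j) (N.T j)

/-- Shaping curve of a server. -/
noncomputable def shapingCurve (j : S) : ℝ≥0 → ℝ≥0∞ := tokenBucket (N.L j) (N.C j)

/-- First server crossed by a flow. -/
def first (i : ι) : S := (N.path i).head (N.path_ne_nil i)

/-- Last server crossed by a flow. -/
def last (i : ι) : S := (N.path i).getLast (N.path_ne_nil i)

/-- Successor of the last server crossed by a flow. -/
def exit (i : ι) : Option S := N.su (N.last i)

/-- Depth of a node: `0` outside, `1` at the sink, and `d(j) = d(su j) + 1`. -/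
noncomputable def depth (v : Option S) : ℕ := by
  classical exact Nat.find (N.reaches v)

theorem depth_none : N.depth none = 0 := by
  classical
  simp [depth]

theorem depth_some (j : S) : N.depth (some j) = N.depth (N.su j) + 1 := by
  classical
  unfold depth
  rw [Nat.find_eq_iff]
  refine ⟨?_, ?_⟩
  · have h := Nat.find_spec (N.reaches (N.su j))
    simpa [Function.iterate_succ_apply] using h
  · intro k hk
    cases k with
    | zero => simp
    | succ k =>
      have h := Nat.find_min (N.reaches (N.su j)) (Nat.lt_of_succ_lt_succ hk)
      simpa [Function.iterate_succ_apply] using h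

/-- Distance of a server to the deepest level; it decreases towards upstream servers. -/
noncomputable def rank [Fintype S] (j : S) : ℕ :=
  (Finset.univ.sup fun p => N.depth (some p)) - N.depth (some j)

theorem rank_lt [Fintype S] {p j : S} (h : N.su p = some j) : N.rank p < N.rank j := by
  have h1 := N.depth_some p
  rw [h] at h1
  have h2 : N.depth (some p) ≤ Finset.univ.sup fun q => N.depth (some q) :=
    Finset.le_sup (f := fun q => N.depth (some q)) (Finset.mem_univ p)
  unfold rank
  omega

variable [DecidableEq S]

/-- The set `Fl(j)` of the flows crossing server `j`. -/
def Fl [Fintype ι] (j : S) : Finset ι := Finset.univ.filter fun i => j ∈ N.path i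

/-- The server of the path of flow `i` that precedes `j`, if there is one. -/
def prev (i : ι) (j : S) : Option S := (N.path i).find? fun p => N.su p = some j

theorem su_of_prev {i : ι} {j p : S} (h : N.prev i j = some p) : N.su p = some j := by
  have := List.find?_some h
  simpa using this

/-! ### Admissible trajectories -/

section Trajectories

variable [Fintype ι]

/-- A family of processes: `F i (some j)` is the process of flow `i` entering server `j`, and
`F i (su j)` its process leaving `j`. Only the nodes of the path of `i` and `exit i` matter. -/
abbrev Trajectory (_ : TreeNetwork S ι) := ι → Option S → ℝ≥0 → ℝ≥0

/-- Aggregate arrival process of server `j`. -/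
def arr (F : N.Trajectory) (j : S) (t : ℝ≥0) : ℝ≥0 := ∑ i ∈ N.Fl j, F i (some j) t

/-- Aggregate departure process of server `j`. -/
def dep (F : N.Trajectory) (j : S) (t : ℝ≥0) : ℝ≥0 := ∑ i ∈ N.Fl j, F i (N.su j) t

/-- `Q j i x` is the amount of data of flow `i` among the first `x` units of data arriving at server
`j`. The data arriving at each server are totally ordered, compatibly with their arrival dates
(`arrives`); they are served in this order (`served`); and data that go from `j` to the next server
arrive there in the order in which they left `j`, even if they leave at the same date (`link`). -/
structure IsDataOrder (F : N.Trajectory) (Q : S → ι → ℝ≥0 → ℝ≥0) : Prop where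
  mono : ∀ j, ∀ i ∈ N.Fl j, ∀ x y, x ≤ y → (∃ t, y ≤ N.arr F j t) → Q j i x ≤ Q j i y
  total : ∀ j x, (∃ t, x ≤ N.arr F j t) → ∑ i ∈ N.Fl j, Q j i x = x
  arrives : ∀ j, ∀ i ∈ N.Fl j, ∀ t, Q j i (N.arr F j t) = F i (some j) t
  served : ∀ j, ∀ i ∈ N.Fl j, ∀ t, Q j i (N.dep F j t) = F i (N.su j) t
  link : ∀ j h, N.su j = some h → ∀ x, (∃ t, x ≤ N.arr F h t) →
    ∃ y, (∃ t, y ≤ N.dep F j t) ∧ ∀ i, i ∈ N.Fl j → i ∈ N.Fl h → Q h i x = Q j i y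

/-- Admissible trajectories. Server `j` is a system with service curve `β_j`, whose output `B` is
reshaped by the greedy shaper `σ_j`. -/
structure Admissible (F : N.Trajectory) : Prop where
  cumul_in : ∀ i, ∀ j ∈ N.path i, IsCumulative (F i (some j))
  cumul_out : ∀ i, ∀ j ∈ N.path i, IsCumulative (F i (N.su j))
  causal : ∀ i, ∀ j ∈ N.path i, ∀ t, F i (N.su j) t ≤ F i (some j) t
  arrival : ∀ i, Constrained (F i (some (N.first i))) (N.arrivalCurve i)
  service_shaping : ∀ j, ∃ B : ℝ≥0 → ℝ≥0, IsCumulative B ∧ (∀ t, B t ≤ N.arr F j t) ∧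
    (∀ t, conv (N.arr F j) (N.serviceCurve j) t ≤ B t) ∧
    (∀ t, (N.dep F j t : ℝ≥0∞) = conv B (N.shapingCurve j) t)
  fifo : ∃ Q : S → ι → ℝ≥0 → ℝ≥0, N.IsDataOrder F Q

/-- Worst-case end-to-end delay of a flow (ending at the sink). -/
noncomputable def worstDelay (i : ι) : ℝ≥0∞ :=
  ⨆ (F : N.Trajectory) (_ : N.Admissible F), delay (F i (some (N.first i))) (F i none)

/-- Worst-case end-to-end backlog of a flow (ending at the sink). -/
noncomputable def worstBacklog (i : ι) : ℝ≥0∞ :=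
  ⨆ (F : N.Trajectory) (_ : N.Admissible F), backlog (F i (some (N.first i))) (F i none)

end Trajectories

/-! ### TFA++ and SFA -/

section Algorithms

variable [Fintype ι]

/-- One step of TFA++: the delay bound of server `j` when the flows crossing it have bursts `c`,
namely the horizontal distance between the curve
`∑_{h ∈ pr(j)} min (σ_h, ∑_{i ∈ Fl(h,j)} γ_{c i, r i}) + ∑_{i starting at j} α_i` and `β_j`. -/
noncomputable def tfaStep [Fintype S] (j : S) (c : ι → ℝ≥0∞) : ℝ≥0∞ :=
  maxDelay
    (fun t => (∑ h ∈ Finset.univ.filter (fun h => N.su h = some j),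
        min (N.shapingCurve h t)
          (∑ i ∈ Finset.univ.filter (fun i => h ∈ N.path i ∧ j ∈ N.path i),
            tokenBucket (c i) (N.r i) t))
      + ∑ i ∈ Finset.univ.filter (fun i => N.first i = j), N.arrivalCurve i t)
    (N.serviceCurve j)

/-- The burst `b_i^{(j)}` of flow `i` at server `j` computed by TFA++. -/
noncomputable def tfaBurst [Fintype S] (j : S) (i : ι) : ℝ≥0∞ :=
  match _h : N.prev i j with
  | none => N.b i
  | some p => tfaBurst p i + N.r i * N.tfaStep p (fun k => tfaBurst p k)
termination_by N.rank j
decreasing_by all_goals exact N.rank_lt (N.su_of_prev _h)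

/-- The TFA++ delay bound `d_j` of server `j`. -/
noncomputable def tfaDelay [Fintype S] (j : S) : ℝ≥0∞ := N.tfaStep j (N.tfaBurst j)

variable [DecidableEq ι]

/-- One step of SFA: the residual latency `T_j + (∑_{k ∈ Fl(j), k ≠ i} c k) / R_j` of flow `i` at
server `j` when the flows crossing it have bursts `c`. -/
noncomputable def sfaStep (j : S) (i : ι) (c : ι → ℝ≥0∞) : ℝ≥0∞ :=
  N.T j + (∑ k ∈ (N.Fl j).erase i, c k) / N.R j

/-- The burst `b_i^{(j)}` of flow `i` at server `j` computed by SFA. -/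
noncomputable def sfaBurst [Fintype S] (j : S) (i : ι) : ℝ≥0∞ :=
  match _h : N.prev i j with
  | none => N.b i
  | some p => sfaBurst p i + N.r i * N.sfaStep p i (fun k => sfaBurst p k)
termination_by N.rank j
decreasing_by all_goals exact N.rank_lt (N.su_of_prev _h)

/-- Residual latency `T_i^{(j)}` computed by SFA. -/
noncomputable def sfaLatency [Fintype S] (i : ι) (j : S) : ℝ≥0∞ := N.sfaStep j i (N.sfaBurst j)

/-- Residual rate `R_i^{(j)} = R_j - ∑_{k ∈ Fl(j), k ≠ i} r_k` (non-negative under local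
stability). -/
noncomputable def sfaRate (i : ι) (j : S) : ℝ≥0 := N.R j - ∑ k ∈ (N.Fl j).erase i, N.r k

/-- The SFA delay bound of flow `i`: `∑_{j ∈ π_i} T_i^{(j)} + b_i / min_{j ∈ π_i} R_i^{(j)}`. -/
noncomputable def sfaDelay [Fintype S] (i : ι) : ℝ≥0∞ :=
  ((N.path i).map (N.sfaLatency i)).sum + N.b i / ⨅ j ∈ N.path i, (N.sfaRate i j : ℝ≥0∞)

end Algorithms

/-! ### The linear program -/

/-- Variables: `t v k` is the `k`-th date (`0 ≤ k ≤ depth v`) attached to the node `v`, and `X i v k`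
the value of the process of flow `i` at node `v` and date `t v k`. Only the indices
`k ≤ depth v` and the nodes `v` of the path of `i` or `v = exit i` are used. The date of exit of
the data of interest is `t none 0`. -/
structure LPVar (_ : TreeNetwork S ι) where
  t : Option S → ℕ → ℝ
  X : ι → Option S → ℕ → ℝ

variable [Fintype ι]

/-- The constraints of the initial linear program. -/
structure BaseFeasible (p : N.LPVar) : Prop where
  time : ∀ j, ∀ k < N.depth (some j), p.t (some j) (k + 1) ≤ p.t (some j) k
  fifo_time : ∀ j, ∀ k ≤ N.depth (N.su j), p.t (some j) k ≤ p.t (N.su j) k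
  fifo : ∀ j, ∀ i ∈ N.Fl j, ∀ k ≤ N.depth (N.su j), p.X i (some j) k = p.X i (N.su j) k
  service_nonneg : ∀ j,
    ∑ i ∈ N.Fl j, p.X i (some j) (N.depth (some j)) ≤
      ∑ i ∈ N.Fl j, p.X i (N.su j) (N.depth (N.su j))
  service_rate : ∀ j,
    ∑ i ∈ N.Fl j, p.X i (some j) (N.depth (some j))
        + N.R j * (p.t (N.su j) (N.depth (N.su j)) - p.t (some j) (N.depth (some j)))
        - N.R j * N.T j ≤
      ∑ i ∈ N.Fl j, p.X i (N.su j) (N.depth (N.su j))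
  arrival : ∀ i, ∀ u v : ℕ, u < v → v ≤ N.depth (some (N.first i)) →
    p.X i (some (N.first i)) u - p.X i (some (N.first i)) v ≤
      N.b i + N.r i * (p.t (some (N.first i)) u - p.t (some (N.first i)) v)
  monotony : ∀ i, ∀ k < N.depth (some (N.first i)),
    p.X i (some (N.first i)) (k + 1) ≤ p.X i (some (N.first i)) k

/-- The constraints of the linear program with the additional TFA++, SFA and shaping constraints. -/
structure Feasible [Fintype S] [DecidableEq ι] (p : N.LPVar) : Prop
    extends N.BaseFeasible p where
  tfa : ∀ j, ∀ k ≤ N.depth (N.su j),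
    ENNReal.ofReal (p.t (N.su j) k - p.t (some j) k) ≤ N.tfaDelay j
  sfa : ∀ i, ∀ k ≤ N.depth (N.exit i),
    ENNReal.ofReal (p.t (N.exit i) k - p.t (some (N.first i)) k) ≤ N.sfaDelay i
  shaping : ∀ j, ∀ u v : ℕ, u < v → v ≤ N.depth (N.su j) →
    ∑ i ∈ N.Fl j, p.X i (N.su j) u - ∑ i ∈ N.Fl j, p.X i (N.su j) v ≤
      N.L j + N.C j * (p.t (N.su j) u - p.t (N.su j) v)

/-- The additional constraints for the backlog of flow `i`, on the additional variable `z`, the value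
at date `t none 0` of the process of flow `i` entering its first server. -/
def BacklogFeasible (i : ι) (p : N.LPVar) (z : ℝ) : Prop :=
  ∀ u ≤ N.depth (some (N.first i)),
    z - p.X i (some (N.first i)) u ≤ N.b i + N.r i * (p.t none 0 - p.t (some (N.first i)) u)

/-- Optimal value of the linear program for the delay of flow `i`. -/
noncomputable def lpDelay [Fintype S] [DecidableEq ι] (i : ι) : EReal :=
  ⨆ (p : N.LPVar) (_ : N.Feasible p), ((p.t none 0 - p.t (some (N.first i)) 0 : ℝ) : EReal)

/-- Optimal value of the linear program for the backlog of flow `i`. -/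
noncomputable def lpBacklog [Fintype S] [DecidableEq ι] (i : ι) : EReal :=
  ⨆ (p : N.LPVar) (z : ℝ) (_ : N.Feasible p ∧ N.BacklogFeasible i p z),
    ((z - p.X i none 0 : ℝ) : EReal)

end TreeNetwork

namespace NetCalc

/-! ### Cumulative processes: latest dates, right limits, attained convolutions -/

/-! An admissible trajectory observed at a date `t₀` gives a feasible point of the linear program
whose objective is at least the delay or backlog observed at `t₀`; both bounds follow by taking
suprema.

The point is built backwards from the exit. Processes may jump, so tracing data back by dates alone
does not give exact FIFO equalities. Each node therefore carries pairs of a date and a position in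
its data order (`state`), and the variables `X` are the shares `Q j i` of the positions. For `k ≤
d(su j)` the pair follows the same data back through `j` (`fifoStep`, `apply_linkPos`), so FIFO
holds exactly; the last pair of `j` is a date attaining its service guarantee. A share lies between
the value of its process at the date and the values after it (`reached_flow`). That is enough for
the arrival and shaping constraints, because a token-bucket bound passes to right limits, even
between equal dates.

For TFA++, the aggregate delay of a server is bounded by a horizontal distance
(`sub_latest_le_maxDelay`), and FIFO turns this delay into a burst increase. For SFA, subtracting
the cross traffic leaves a residual service (`exists_residual_service`); chaining it along the path
pays the burst of the flow only once (`state_exit_le_of_pos`). A zero residual rate with a finite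
bound means a flow without data (`state_exit_le_of_null`). -/

theorem IsCumulative.sum {κ : Type*} {s : Finset κ} {G : κ → ℝ≥0 → ℝ≥0}
    (h : ∀ k ∈ s, IsCumulative (G k)) : IsCumulative fun t => ∑ k ∈ s, G k t where
  mono := fun _ _ hab => Finset.sum_le_sum fun k hk => (h k hk).mono hab
  leftCont := fun t => tendsto_finsetSum _ fun k hk => (h k hk).leftCont t
  zero := Finset.sum_eq_zero fun k hk => (h k hk).zero

/-- The latest date `s ≤ t` at which the process `A` does not exceed `y`. -/
noncomputable def latest (A : ℝ≥0 → ℝ≥0) (t y : ℝ≥0) : ℝ≥0 := sSup {s | s ≤ t ∧ A s ≤ y}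

section Latest

variable {A : ℝ≥0 → ℝ≥0} {s t t' y y' : ℝ≥0}

theorem bddAbove_latest (A : ℝ≥0 → ℝ≥0) (t y : ℝ≥0) : BddAbove {s | s ≤ t ∧ A s ≤ y} :=
  ⟨t, fun _ hs => hs.1⟩

theorem nonempty_latest (hA : A 0 = 0) (t y : ℝ≥0) : {s | s ≤ t ∧ A s ≤ y}.Nonempty :=
  ⟨0, zero_le, by rw [hA]; exact zero_le⟩

theorem latest_le (hA : A 0 = 0) : latest A t y ≤ t :=
  csSup_le (nonempty_latest hA t y) fun _ hs => hs.1

theorem le_latest (hs : s ≤ t) (h : A s ≤ y) : s ≤ latest A t y :=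
  le_csSup (bddAbove_latest A t y) ⟨hs, h⟩

theorem latest_mono (hA : A 0 = 0) (ht : t ≤ t') (hy : y ≤ y') : latest A t y ≤ latest A t' y' :=
  csSup_le_csSup (bddAbove_latest A t' y') (nonempty_latest hA t y)
    fun _ hs => ⟨hs.1.trans ht, hs.2.trans hy⟩

theorem lt_of_latest_lt (h : latest A t y < s) (hs : s ≤ t) : y < A s := by
  by_contra hc
  exact absurd (le_latest hs (not_lt.1 hc)) (not_le.2 h)

/-- The supremum is approached from the left by dates of the set, so left-continuity is exactly what
is needed. -/
theorem IsCumulative.apply_latest_le (hA : IsCumulative A) : A (latest A t y) ≤ y := by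
  have hl := isLUB_csSup (nonempty_latest hA.zero t y) (bddAbove_latest A t y)
  have hc := hl.mem_closure (nonempty_latest hA.zero t y)
  have : (nhdsWithin (latest A t y) {s | s ≤ t ∧ A s ≤ y}).NeBot :=
    mem_closure_iff_nhdsWithin_neBot.1 hc
  have ht : Filter.Tendsto A (nhdsWithin (latest A t y) {s | s ≤ t ∧ A s ≤ y})
      (nhds (A (latest A t y))) :=
    (hA.leftCont _).mono_left (nhdsWithin_mono _ fun s hs => hl.1 hs)
  exact le_of_tendsto ht (eventually_nhdsWithin_of_forall fun s hs => hs.2)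

end Latest

/-- The position `x` is reached by the process `A` at date `t`: it lies between the value of `A` at
`t` and the values of `A` after `t`. -/
def Reached (A : ℝ≥0 → ℝ≥0) (t x : ℝ≥0) : Prop := A t ≤ x ∧ ∀ s, t < s → x ≤ A s

theorem Reached.apply {A : ℝ≥0 → ℝ≥0} (hA : Monotone A) (t : ℝ≥0) : Reached A t (A t) :=
  ⟨le_rfl, fun _ hs => hA hs.le⟩

theorem Reached.exists_le {A : ℝ≥0 → ℝ≥0} {t x : ℝ≥0} (h : Reached A t x) : ∃ s, x ≤ A s :=
  ⟨t + 1, h.2 _ (lt_add_of_pos_right t one_pos)⟩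

theorem Reached.latest {A D : ℝ≥0 → ℝ≥0} {t y : ℝ≥0} (hA : IsCumulative A) (hDA : ∀ s, D s ≤ A s)
    (h : Reached D t y) : Reached A (latest A t y) y := by
  refine ⟨hA.apply_latest_le, fun s hs => ?_⟩
  rcases le_or_gt s t with hst | hst
  · exact (lt_of_latest_lt hs hst).le
  · exact (h.2 s hst).trans (hDA s)

/-- Value of a process just after a date. -/
noncomputable def rightValue (A : ℝ≥0 → ℝ≥0) (t : ℝ≥0) : ℝ≥0 := ⨅ s : Set.Ioi t, A s

theorem rightValue_le {A : ℝ≥0 → ℝ≥0} {s t : ℝ≥0} (h : t < s) : rightValue A t ≤ A s :=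
  ciInf_le (OrderBot.bddBelow _) (⟨s, h⟩ : Set.Ioi t)

theorem le_rightValue {A : ℝ≥0 → ℝ≥0} {t x : ℝ≥0} (h : ∀ s, t < s → x ≤ A s) :
    x ≤ rightValue A t := le_ciInf fun s => h s s.2

theorem rightValue_mono {A : ℝ≥0 → ℝ≥0} {t t' : ℝ≥0} (h : t ≤ t') :
    rightValue A t ≤ rightValue A t' := le_rightValue fun _ hs => rightValue_le (h.trans_lt hs)

theorem le_rightValue_self {A : ℝ≥0 → ℝ≥0} (hA : Monotone A) (t : ℝ≥0) : A t ≤ rightValue A t :=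
  le_rightValue fun _ hs => hA hs.le

theorem exists_lt_of_rightValue_lt {A : ℝ≥0 → ℝ≥0} {t x : ℝ≥0} (h : rightValue A t < x) :
    ∃ s, t < s ∧ A s < x := by
  obtain ⟨⟨s, hs⟩, h'⟩ := exists_lt_of_ciInf_lt h
  exact ⟨s, hs, h'⟩

theorem le_affine_of_forall_gt {x a c : ℝ} {t : ℝ≥0} (h : ∀ s : ℝ≥0, t < s → x ≤ a + c * s) :
    x ≤ a + c * t := by
  have hc : Filter.Tendsto (fun s : ℝ≥0 => a + c * (s : ℝ)) (nhdsWithin t (Set.Ioi t))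
      (nhds (a + c * t)) := by
    have : Continuous fun s : ℝ≥0 => a + c * (s : ℝ) := by fun_prop
    exact (this.tendsto t).mono_left nhdsWithin_le_nhds
  exact ge_of_tendsto hc (eventually_nhdsWithin_of_forall fun s hs => h s hs)

theorem IsCumulative.lowerSemicontinuous {A : ℝ≥0 → ℝ≥0} (hA : IsCumulative A) :
    LowerSemicontinuous A := by
  intro t y hy
  have h := (hA.leftCont t).eventually (lt_mem_nhds hy)
  rw [eventually_nhdsWithin_iff] at h
  filter_upwards [h] with s hs
  rcases le_total s t with hst | hst
  · exact hs hst
  · exact hy.trans_le (hA.mono hst)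

/-- A lower semicontinuous function attains its minimum on a compact interval. The linear program
needs an actual date, not only an infimum. -/
theorem IsCumulative.exists_of_conv_le {A : ℝ≥0 → ℝ≥0} (hA : IsCumulative A) {R T t x : ℝ≥0}
    (h : conv A (rateLatency R T) t ≤ x) : ∃ s ≤ t, A s + R * (t - s - T) ≤ x := by
  have hl : LowerSemicontinuousOn (fun s => A s + R * (t - s - T)) (Set.Iic t) := by
    have h2 : Continuous fun s : ℝ≥0 => R * (t - s - T) := by fun_prop
    exact ((hA.lowerSemicontinuous).add h2.lowerSemicontinuous).lowerSemicontinuousOn _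
  have hcomp : IsCompact (Set.Iic t) := by
    rw [← Set.Icc_bot]; exact isCompact_Icc
  obtain ⟨s, hs, hmin⟩ := LowerSemicontinuousOn.exists_isMinOn (s := Set.Iic t) ⟨t, Set.self_mem_Iic⟩ hcomp hl
  refine ⟨s, hs, ?_⟩
  rw [← ENNReal.coe_le_coe]
  refine le_trans ?_ h
  refine le_iInf₂ fun u hu => ?_
  have := hmin hu
  simp only [Set.mem_ofPred_eq] at this
  unfold rateLatency
  exact_mod_cast this

/-! ### Token buckets -/

theorem tokenBucket_le (c : ℝ≥0∞) (r t : ℝ≥0) : tokenBucket c r t ≤ c + r * t := by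
  unfold tokenBucket
  split_ifs <;> simp

theorem Constrained.le_add {G : ℝ≥0 → ℝ≥0} {c : ℝ≥0∞} {r s t : ℝ≥0}
    (h : Constrained G (tokenBucket c r)) (hst : s ≤ t) :
    (G t : ℝ≥0∞) ≤ G s + (c + r * (t - s : ℝ≥0)) :=
  (h s t hst).trans (by gcongr; exact tokenBucket_le _ _ _)

theorem constrained_of_lt {G : ℝ≥0 → ℝ≥0} {c : ℝ≥0∞} {r : ℝ≥0}
    (h : ∀ s t, s < t → (G t : ℝ≥0∞) ≤ G s + (c + r * (t - s : ℝ≥0))) :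
    Constrained G (tokenBucket c r) := by
  intro s t hst
  rcases hst.eq_or_lt with rfl | hlt
  · simp
  · have : t - s ≠ 0 := (tsub_pos_of_lt hlt).ne'
    simpa [tokenBucket, this] using h s t hlt

theorem Constrained.le_add_real {G : ℝ≥0 → ℝ≥0} {c : ℝ≥0∞} {r s t : ℝ≥0}
    (h : Constrained G (tokenBucket c r)) (hc : c ≠ ⊤) (hst : s ≤ t) :
    (G t : ℝ) ≤ G s + (c.toReal + r * (t - s)) := by
  have h1 := h.le_add hst
  lift c to ℝ≥0 using hc
  have h2 : G t ≤ G s + (c + r * (t - s)) := by exact_mod_cast h1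
  have h3 : (G t : ℝ) ≤ ((G s + (c + r * (t - s)) : ℝ≥0) : ℝ) := by exact_mod_cast h2
  simpa [NNReal.coe_sub hst] using h3

/-- Only dates `u > t ≥ s` are compared with `s`, so the full burst is available even when `s = t`.
-/
theorem Constrained.le_add_real_of_forall_gt {G : ℝ≥0 → ℝ≥0} {c : ℝ≥0∞} {r s t x : ℝ≥0}
    (h : Constrained G (tokenBucket c r)) (hc : c ≠ ⊤) (hst : s ≤ t)
    (hx : ∀ u, t < u → x ≤ G u) : (x : ℝ) ≤ G s + (c.toReal + r * (t - s)) := by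
  have := le_affine_of_forall_gt (x := x) (a := G s + c.toReal - r * s) (c := r) (t := t)
    fun u hu => by
      have h1 := h.le_add_real hc (hst.trans hu.le)
      have h2 : (x : ℝ) ≤ G u := by exact_mod_cast hx u hu
      linarith
  linarith

/-- A system with service curve `β_{R,T}` whose output is reshaped by a greedy shaper of rate at
least `R` still has the service curve `β_{R,T}`. -/
theorem conv_le_conv_of_le {A B : ℝ≥0 → ℝ≥0} {R T C : ℝ≥0} {L : ℝ≥0∞} (hRC : R ≤ C)
    (h : ∀ t, conv A (rateLatency R T) t ≤ B t) (t : ℝ≥0) :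
    conv A (rateLatency R T) t ≤ conv B (tokenBucket L C) t := by
  refine le_iInf₂ fun s (hs : s ≤ t) => ?_
  rcases hs.eq_or_lt with rfl | hlt
  · exact (h s).trans le_self_add
  -- The curve `β_{R,T}` grows at rate at most `R ≤ C`.
  have h1 : conv A (rateLatency R T) t ≤ conv A (rateLatency R T) s + C * (t - s : ℝ≥0) := by
    unfold conv
    simp only [ENNReal.iInf_add]
    refine le_iInf₂ fun u (hu : u ≤ s) => (iInf₂_le u (show u ∈ Set.Iic t from hu.trans hs)).trans ?_
    rw [add_assoc]
    gcongr
    unfold rateLatency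
    norm_cast
    have h2 : t - u - T ≤ (s - u - T) + (t - s) := by
      rw [tsub_le_iff_right, tsub_le_iff_right]
      have h3 : s ≤ (s - u - T) + T + u := by
        rw [← tsub_le_iff_right, ← tsub_le_iff_right]
      calc t = s + (t - s) := (add_tsub_cancel_of_le hs).symm
        _ ≤ (s - u - T) + T + u + (t - s) := by gcongr
        _ = _ := by ring
    calc R * (t - u - T) ≤ R * ((s - u - T) + (t - s)) := by gcongr
      _ = R * (s - u - T) + R * (t - s) := mul_add _ _ _
      _ ≤ _ := by gcongr
  refine h1.trans (add_le_add (h s) ?_)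
  have : t - s ≠ 0 := (tsub_pos_of_lt hlt).ne'
  simp [tokenBucket, this]

/-- For a fixed `u`, going from `s` to `t` raises the shaping term by `C (t - s)`, plus the burst
`L` when `u = s`, since the token bucket vanishes at `0`. -/
theorem constrained_of_eq_conv {B D : ℝ≥0 → ℝ≥0} {L : ℝ≥0∞} {C : ℝ≥0}
    (h : ∀ t, (D t : ℝ≥0∞) = conv B (tokenBucket L C) t) : Constrained D (tokenBucket L C) := by
  refine constrained_of_lt fun s t hst => ?_
  rw [h s, h t]
  unfold conv
  simp only [ENNReal.iInf_add]
  refine le_iInf₂ fun u (hu : u ≤ s) => (iInf₂_le u (show u ∈ Set.Iic t from hu.trans hst.le)).trans ?_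
  have hne : t - u ≠ 0 := (tsub_pos_of_lt (hu.trans_lt hst)).ne'
  rw [add_assoc]
  gcongr
  have hsum : ((t - u : ℝ≥0) : ℝ≥0∞) = (s - u : ℝ≥0) + (t - s : ℝ≥0) := by
    norm_cast
    rw [add_comm, tsub_add_tsub_cancel hst.le hu]
  by_cases hsu : s - u = 0
  · simp [tokenBucket, hne, hsum, hsu]
  · simp only [tokenBucket, hne, hsu, if_false, hsum, mul_add]
    rw [← add_assoc]
    gcongr
    exact le_add_self

end NetCalc

/-! ### Neighbours in a chain -/

theorem List.IsChain.exists_rel_of_ne_getLast {α : Type*} {r : α → α → Prop} {l : List α}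
    (hl : l.IsChain r) (hne : l ≠ []) {a : α} (ha : a ∈ l) (h : a ≠ l.getLast hne) :
    ∃ b ∈ l, r a b := by
  obtain ⟨s, t, rfl⟩ := List.append_of_mem ha
  cases t with
  | nil => simp at h
  | cons b t =>
    refine ⟨b, by simp, ?_⟩
    have := (List.isChain_append.1 hl).2.1
    exact (List.isChain_cons_cons.1 this).1

theorem List.IsChain.exists_rel_of_ne_head {α : Type*} {r : α → α → Prop} {l : List α}
    (hl : l.IsChain r) (hne : l ≠ []) {b : α} (hb : b ∈ l) (h : b ≠ l.head hne) :
    ∃ a ∈ l, r a b := by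
  obtain ⟨s, t, rfl⟩ := List.append_of_mem hb
  rcases List.eq_nil_or_concat s with rfl | ⟨s, a, rfl⟩
  · simp at h
  · refine ⟨a, by simp, ?_⟩
    exact (List.isChain_append.1 hl).2.2 a (by simp) b (by simp)

namespace TreeNetwork

open NetCalc

variable {S ι : Type*} (N : TreeNetwork S ι)

/-! ### Paths -/

theorem first_mem (i : ι) : N.first i ∈ N.path i := List.head_mem _

theorem last_mem (i : ι) : N.last i ∈ N.path i := List.getLast_mem _

theorem exists_su_of_ne_last {i : ι} {j : S} (hj : j ∈ N.path i) (h : j ≠ N.last i) :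
    ∃ h ∈ N.path i, N.su j = some h := by
  obtain ⟨h, hm, hr⟩ := (N.path_chain i).exists_rel_of_ne_getLast (N.path_ne_nil i) hj h
  exact ⟨h, hm, hr⟩

theorem exists_pred_of_ne_first {i : ι} {j : S} (hj : j ∈ N.path i) (h : j ≠ N.first i) :
    ∃ p ∈ N.path i, N.su p = some j :=
  (N.path_chain i).exists_rel_of_ne_head (N.path_ne_nil i) hj h

theorem depth_su_lt (j : S) : N.depth (N.su j) < N.depth (some j) := by
  rw [N.depth_some]; exact Nat.lt_succ_self _

variable [DecidableEq S]

theorem prev_mem {i : ι} {j p : S} (h : N.prev i j = some p) : p ∈ N.path i :=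
  List.mem_of_find?_eq_some h

theorem eq_first_of_prev_eq_none {i : ι} {j : S} (hj : j ∈ N.path i) (h : N.prev i j = none) :
    j = N.first i := by
  by_contra hne
  obtain ⟨p, hp, hsu⟩ := N.exists_pred_of_ne_first hj hne
  have := List.find?_eq_none.1 h p hp
  simp [hsu] at this

variable [Fintype ι]

theorem mem_Fl {i : ι} {j : S} : i ∈ N.Fl j ↔ j ∈ N.path i := by simp [Fl]

/-! ### Admissible trajectories -/

omit [DecidableEq S] [Fintype ι] in
theorem shaper_rate_le (hshaper : ∀ j t, N.serviceCurve j t ≤ N.shapingCurve j t) (j : S) :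
    N.R j ≤ N.C j := by
  by_contra hlt
  rw [not_le] at hlt
  have hpos : (0 : ℝ) < N.R j - N.C j := sub_pos.2 (by exact_mod_cast hlt)
  -- Chosen so that a gain at rate `R - C` over `t` exceeds `L + R T` by `1`.
  set t : ℝ≥0 := (N.L j + N.R j * N.T j + 1) / (N.R j - N.C j) with ht
  have htr : (t : ℝ) * (N.R j - N.C j) = N.L j + N.R j * N.T j + 1 := by
    rw [ht, NNReal.coe_div, NNReal.coe_sub hlt.le]
    push_cast
    field_simp
  have htpos : t ≠ 0 := by
    intro h0
    rw [h0] at htr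
    have : (0 : ℝ) ≤ N.L j + N.R j * N.T j := by positivity
    simp at htr
    linarith
  have h := hshaper j t
  simp only [serviceCurve, shapingCurve, rateLatency, tokenBucket, htpos, if_false] at h
  have h1 : N.R j * (t - N.T j) ≤ N.L j + N.C j * t := by exact_mod_cast h
  have h2 : ((N.R j * (t - N.T j) : ℝ≥0) : ℝ) ≤ N.L j + N.C j * t := by exact_mod_cast h1
  have h3 : (t : ℝ) - N.T j ≤ ((t - N.T j : ℝ≥0) : ℝ) := by
    rw [NNReal.coe_sub_def]; exact le_max_left _ _
  have h4 := mul_le_mul_of_nonneg_left h3 (N.R j).coe_nonneg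
  push_cast at h2
  nlinarith

namespace Admissible

variable {N} {F : N.Trajectory} (hF : N.Admissible F)

include hF

theorem isCumulative_arr (j : S) : IsCumulative (N.arr F j) :=
  IsCumulative.sum fun i hi => hF.cumul_in i j (N.mem_Fl.1 hi)

theorem isCumulative_dep (j : S) : IsCumulative (N.dep F j) :=
  IsCumulative.sum fun i hi => hF.cumul_out i j (N.mem_Fl.1 hi)

theorem dep_le_arr (j : S) (t : ℝ≥0) : N.dep F j t ≤ N.arr F j t :=
  Finset.sum_le_sum fun i hi => hF.causal i j (N.mem_Fl.1 hi) t

theorem constrained_dep (j : S) : Constrained (N.dep F j) (N.shapingCurve j) := by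
  obtain ⟨B, -, -, -, h⟩ := hF.service_shaping j
  exact constrained_of_eq_conv h

theorem exists_service (hshaper : ∀ j t, N.serviceCurve j t ≤ N.shapingCurve j t) (j : S)
    (t : ℝ≥0) : ∃ s ≤ t, N.arr F j s + N.R j * (t - s - N.T j) ≤ N.dep F j t := by
  obtain ⟨B, -, -, h1, h2⟩ := hF.service_shaping j
  refine (hF.isCumulative_arr j).exists_of_conv_le ?_
  rw [h2 t]
  exact conv_le_conv_of_le (N.shaper_rate_le hshaper j) h1 t

end Admissible

/-! ### Positions in the data order -/

namespace IsDataOrder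

variable {N} {F : N.Trajectory} {Q : S → ι → ℝ≥0 → ℝ≥0} (hQ : N.IsDataOrder F Q)

include hQ

/-- The shares of the other flows do not decrease and all shares sum to the position, so each share
is 1-Lipschitz. This continuity gives access to infima of positions and to right limits. -/
theorem le_add_sub {j : S} {i : ι} (hi : i ∈ N.Fl j) {x y : ℝ≥0} (hxy : x ≤ y)
    (hy : ∃ t, y ≤ N.arr F j t) : Q j i y ≤ Q j i x + (y - x) := by
  classical
  obtain ⟨t, ht⟩ := hy
  have h1 := hQ.total j y ⟨t, ht⟩
  have h2 := hQ.total j x ⟨t, hxy.trans ht⟩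
  rw [← Finset.add_sum_erase _ _ hi] at h1 h2
  have h3 : ∑ k ∈ (N.Fl j).erase i, Q j k x ≤ ∑ k ∈ (N.Fl j).erase i, Q j k y :=
    Finset.sum_le_sum fun k hk => hQ.mono j k (Finset.mem_of_mem_erase hk) x y hxy ⟨t, ht⟩
  rw [← NNReal.coe_le_coe] at h3 ⊢
  rw [NNReal.coe_add, NNReal.coe_sub hxy]
  rw [← NNReal.coe_inj, NNReal.coe_add] at h1 h2
  linarith

end IsDataOrder

/-- Positions at the output of server `j` that are linked to position `x` at the next server. -/
def linkSet (F : N.Trajectory) (Q : S → ι → ℝ≥0 → ℝ≥0) (j : S) (x : ℝ≥0) : Set ℝ≥0 :=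
  {y | (∃ t, y ≤ N.dep F j t) ∧
    ∀ h, N.su j = some h → ∀ i ∈ N.Fl j, i ∈ N.Fl h → Q h i x = Q j i y}

/-- The position at the output of server `j` at date `t` that corresponds to position `x` at the
next server: the first linked position, moved into the range of the departure process around `t`. -/
noncomputable def linkPos (F : N.Trajectory) (Q : S → ι → ℝ≥0 → ℝ≥0) (j : S) (t x : ℝ≥0) : ℝ≥0 :=
  max (N.dep F j t) (min (sInf (N.linkSet F Q j x)) (rightValue (N.dep F j) t))

section Link

variable {N} {F : N.Trajectory} {Q : S → ι → ℝ≥0 → ℝ≥0}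

theorem reached_linkPos (hF : N.Admissible F) (j : S) (t x : ℝ≥0) :
    Reached (N.dep F j) t (N.linkPos F Q j t x) :=
  ⟨le_max_left _ _, fun _ hs => max_le ((hF.isCumulative_dep j).mono hs.le)
    ((min_le_right _ _).trans (rightValue_le hs))⟩

theorem sInf_mem_linkSet (hF : N.Admissible F) (hQ : N.IsDataOrder F Q) {j : S} {x : ℝ≥0}
    (hne : (N.linkSet F Q j x).Nonempty) : sInf (N.linkSet F Q j x) ∈ N.linkSet F Q j x := by
  have hb : BddBelow (N.linkSet F Q j x) := OrderBot.bddBelow _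
  obtain ⟨y, hy⟩ := hne
  obtain ⟨t, ht⟩ := hy.1
  refine ⟨⟨t, (csInf_le hb hy).trans ht⟩, fun h hsu i hij hih => ?_⟩
  have hmono : ∀ z ∈ N.linkSet F Q j x, Q j i (sInf (N.linkSet F Q j x)) ≤ Q j i z ∧
      Q j i z ≤ Q j i (sInf (N.linkSet F Q j x)) + (z - sInf (N.linkSet F Q j x)) := by
    intro z hz
    obtain ⟨s, hs⟩ := hz.1
    have hs' : ∃ t, z ≤ N.arr F j t := ⟨s, hs.trans (hF.dep_le_arr j s)⟩
    exact ⟨hQ.mono j i hij _ _ (csInf_le hb hz) hs', hQ.le_add_sub hij (csInf_le hb hz) hs'⟩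
  refine le_antisymm ?_ ((hy.2 h hsu i hij hih).symm ▸ (hmono y hy).1)
  refine le_of_forall_pos_le_add fun ε hε => ?_
  obtain ⟨z, hz, hzε⟩ := exists_lt_of_csInf_lt ⟨y, hy⟩
    (lt_add_of_pos_right (sInf (N.linkSet F Q j x)) hε)
  rw [hz.2 h hsu i hij hih]
  refine (hmono z hz).2.trans ?_
  gcongr
  rw [tsub_le_iff_left]
  exact hzε.le

theorem linkSet_nonempty (hQ : N.IsDataOrder F Q) {j : S} {t x : ℝ≥0}
    (hx : ∀ h, N.su j = some h → Reached (N.arr F h) t x) : (N.linkSet F Q j x).Nonempty := by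
  cases hsu : N.su j with
  | none => exact ⟨0, ⟨0, zero_le⟩, fun h hh => by simp [hsu] at hh⟩
  | some h =>
    obtain ⟨y, hy, hl⟩ := hQ.link j h hsu x (hx h hsu).exists_le
    refine ⟨y, hy, fun h' hh' => ?_⟩
    obtain rfl : h = h' := Option.some.inj (hsu.symm.trans hh')
    exact hl

/-- Moving the linked position into the range of departures around `t` is harmless: the share at `x`
already lies between the shares at the two ends of this range, so a linked position outside it has
the same share as the nearest end. -/
theorem apply_linkPos (hF : N.Admissible F) (hQ : N.IsDataOrder F Q) {j h : S} {t x : ℝ≥0}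
    (hsu : N.su j = some h) (hx : Reached (N.arr F h) t x) {i : ι} (hij : i ∈ N.Fl j)
    (hih : i ∈ N.Fl h) : Q h i x = Q j i (N.linkPos F Q j t x) := by
  have hne : (N.linkSet F Q j x).Nonempty := linkSet_nonempty hQ (t := t) fun h' hh' => by
    obtain rfl : h = h' := Option.some.inj (hsu.symm.trans hh')
    exact hx
  obtain ⟨⟨s, hs⟩, hy⟩ := sInf_mem_linkSet hF hQ hne
  have hyQ := hy h hsu i hij hih
  set y := sInf (N.linkSet F Q j x) with hydef
  have hout : ∀ u, Q j i (N.dep F j u) = Q h i (N.arr F h u) := fun u => by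
    rw [hQ.served j i hij, hQ.arrives h i hih, hsu]
  have hdom : ∀ u, ∃ v, N.dep F j u ≤ N.arr F j v := fun u => ⟨u, hF.dep_le_arr j u⟩
  have hlow : Q j i (N.dep F j t) ≤ Q h i x := by
    rw [hout]; exact hQ.mono h i hih _ _ hx.1 hx.exists_le
  have hdr := le_rightValue_self (hF.isCumulative_dep j).mono t
  rcases le_total y (N.dep F j t) with h1 | h1
  · have : N.linkPos F Q j t x = N.dep F j t := by
      unfold linkPos; rw [← hydef, min_eq_left (h1.trans hdr), max_eq_left h1]
    rw [this]
    exact le_antisymm (hyQ.le.trans (hQ.mono j i hij _ _ h1 (hdom t))) hlow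
  rcases le_total y (rightValue (N.dep F j) t) with h2 | h2
  · have : N.linkPos F Q j t x = y := by
      unfold linkPos; rw [← hydef, min_eq_left h2, max_eq_right h1]
    rw [this]
    exact hyQ
  · have : N.linkPos F Q j t x = rightValue (N.dep F j) t := by
      unfold linkPos; rw [← hydef, min_eq_right h2, max_eq_right hdr]
    rw [this]
    refine le_antisymm ?_ ?_
    · refine le_of_forall_pos_le_add fun ε hε => ?_
      obtain ⟨u, hu, hlt⟩ := exists_lt_of_rightValue_lt
        (lt_add_of_pos_right (rightValue (N.dep F j) t) hε)
      calc Q h i x ≤ Q h i (N.arr F h u) := hQ.mono h i hih _ _ (hx.2 u hu) ⟨u, le_rfl⟩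
        _ = Q j i (N.dep F j u) := (hout u).symm
        _ ≤ Q j i (rightValue (N.dep F j) t) + (N.dep F j u - rightValue (N.dep F j) t) :=
          hQ.le_add_sub hij (rightValue_le hu) (hdom u)
        _ ≤ _ := by
          gcongr
          rw [tsub_le_iff_left]
          exact hlt.le
    · rw [hyQ]
      exact hQ.mono j i hij _ _ h2 ⟨s, hs.trans (hF.dep_le_arr j s)⟩

/-- This is why the least linked position is chosen: if it decreased from `x` to `x'`, the shares at
the smaller position would be squeezed to those at `x`, making it linked to `x` as well. -/
theorem linkPos_mono (hF : N.Admissible F) (hQ : N.IsDataOrder F Q) {j : S} {t x t' x' : ℝ≥0}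
    (ht : t ≤ t') (hxx : x ≤ x') (hx : ∀ h, N.su j = some h → Reached (N.arr F h) t x)
    (hx' : ∀ h, N.su j = some h → Reached (N.arr F h) t' x') :
    N.linkPos F Q j t x ≤ N.linkPos F Q j t' x' := by
  have key : sInf (N.linkSet F Q j x) ≤ sInf (N.linkSet F Q j x') := by
    have hm := sInf_mem_linkSet hF hQ (linkSet_nonempty hQ hx)
    have hm' := sInf_mem_linkSet hF hQ (linkSet_nonempty hQ hx')
    by_contra hlt
    rw [not_le] at hlt
    refine absurd (csInf_le (OrderBot.bddBelow _) ?_) (not_le.2 hlt)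
    refine ⟨hm'.1, fun h hsu i hij hih => ?_⟩
    obtain ⟨s, hs⟩ := hm.1
    refine le_antisymm ?_ ?_
    · rw [← hm'.2 h hsu i hij hih]
      exact hQ.mono h i hih _ _ hxx (hx' h hsu).exists_le
    · rw [hm.2 h hsu i hij hih]
      exact hQ.mono j i hij _ _ hlt.le ⟨s, hs.trans (hF.dep_le_arr j s)⟩
  unfold linkPos
  gcongr
  · exact (hF.isCumulative_dep j).mono ht
  · exact rightValue_mono ht

end Link

/-! ### Dates and positions attached to the nodes -/

/-- The date and position that correspond, at the input of server `j`, to the date `p.1` and the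
position `p.2` at the next node: they concern the same data. -/
noncomputable def fifoStep (F : N.Trajectory) (Q : S → ι → ℝ≥0 → ℝ≥0) (j : S) (p : ℝ≥0 × ℝ≥0) :
    ℝ≥0 × ℝ≥0 :=
  (latest (N.arr F j) p.1 (N.linkPos F Q j p.1 p.2), N.linkPos F Q j p.1 p.2)

/-- A date at which the service guarantee of server `j` for date `t` is attained. -/
noncomputable def serviceDate (F : N.Trajectory) (j : S) (t : ℝ≥0) : ℝ≥0 :=
  Classical.epsilon fun s => s ≤ t ∧ N.arr F j s + N.R j * (t - s - N.T j) ≤ N.dep F j t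

end TreeNetwork

namespace TreeNetwork

open NetCalc

variable {S ι : Type*} (N : TreeNetwork S ι) [DecidableEq S] [Fintype ι]

/-- The dates and positions attached to the nodes, for a trajectory observed at date `t₀`. -/
noncomputable def state (F : N.Trajectory) (Q : S → ι → ℝ≥0 → ℝ≥0) (t₀ : ℝ≥0) (v : Option S)
    (k : ℕ) : ℝ≥0 × ℝ≥0 :=
  match v with
  -- The position `0` is a dummy: outside, the link condition is vacuous, and `linkPos` at the sink
  -- ignores it.
  | none => (t₀, 0)
  | some j =>
    -- As `d(j) = d(su j) + 1`, the other branch concerns the single index `k = d(j)`; larger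
    -- indices repeat it, so that monotony in `k` holds without restriction.
    if k ≤ N.depth (N.su j) then N.fifoStep F Q j (state F Q t₀ (N.su j) k)
    else
      (N.serviceDate F j (state F Q t₀ (N.su j) (N.depth (N.su j))).1,
        N.arr F j (N.serviceDate F j (state F Q t₀ (N.su j) (N.depth (N.su j))).1))
termination_by N.depth v
decreasing_by all_goals exact N.depth_su_lt j

variable {N} {F : N.Trajectory} {Q : S → ι → ℝ≥0 → ℝ≥0}

section State

variable (F Q) (t₀ : ℝ≥0)

theorem state_none (k : ℕ) : N.state F Q t₀ none k = (t₀, 0) := by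
  rw [state]

theorem state_some_of_le {j : S} {k : ℕ} (h : k ≤ N.depth (N.su j)) :
    N.state F Q t₀ (some j) k = N.fifoStep F Q j (N.state F Q t₀ (N.su j) k) := by
  rw [state, if_pos h]

theorem state_some_of_lt {j : S} {k : ℕ} (h : N.depth (N.su j) < k) :
    N.state F Q t₀ (some j) k =
      (N.serviceDate F j (N.state F Q t₀ (N.su j) (N.depth (N.su j))).1,
        N.arr F j (N.serviceDate F j (N.state F Q t₀ (N.su j) (N.depth (N.su j))).1)) := by
  rw [state, if_neg (not_le.2 h)]

end State

/-! ### Order and reachability of the attached dates and positions -/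

theorem serviceDate_spec (hF : N.Admissible F)
    (hshaper : ∀ j t, N.serviceCurve j t ≤ N.shapingCurve j t) (j : S) (t : ℝ≥0) :
    N.serviceDate F j t ≤ t ∧
      N.arr F j (N.serviceDate F j t) + N.R j * (t - N.serviceDate F j t - N.T j) ≤
        N.dep F j t :=
  Classical.epsilon_spec (hF.exists_service hshaper j t)

/-- Monotony of `linkPos` requires reached positions at the next node, so both properties go through
one induction on the depth. -/
theorem state_invariant (hF : N.Admissible F) (hQ : N.IsDataOrder F Q)
    (hshaper : ∀ j t, N.serviceCurve j t ≤ N.shapingCurve j t) (t₀ : ℝ≥0) (v : Option S) :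
    Antitone (N.state F Q t₀ v) ∧ ∀ j, v = some j → ∀ k,
      Reached (N.arr F j) (N.state F Q t₀ v k).1 (N.state F Q t₀ v k).2 := by
  induction hn : N.depth v using Nat.strong_induction_on generalizing v with
  | _ n ih =>
    cases v with
    | none => exact ⟨fun k l _ => by simp [state_none], fun j hj => by simp at hj⟩
    | some j =>
      obtain ⟨hanti, hreach⟩ := ih _ (hn ▸ N.depth_su_lt j) (N.su j) rfl
      have hr : ∀ k h, N.su j = some h → Reached (N.arr F h) (N.state F Q t₀ (N.su j) k).1
          (N.state F Q t₀ (N.su j) k).2 := fun k h hsu => hreach h hsu k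
      have hA := hF.isCumulative_arr j
      have hserv := serviceDate_spec hF hshaper j
      have hfifo : ∀ k l, k ≤ l → N.fifoStep F Q j (N.state F Q t₀ (N.su j) l) ≤
          N.fifoStep F Q j (N.state F Q t₀ (N.su j) k) := fun k l hkl => by
        have hm := linkPos_mono hF hQ (hanti hkl).1 (hanti hkl).2 (hr l) (hr k)
        exact ⟨latest_mono hA.zero (hanti hkl).1 hm, hm⟩
      refine ⟨fun k l hkl => ?_, ?_⟩
      · rcases le_or_gt l (N.depth (N.su j)) with hl | hl
        · rw [state_some_of_le F Q t₀ hl, state_some_of_le F Q t₀ (hkl.trans hl)]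
          exact hfifo k l hkl
        · rw [state_some_of_lt F Q t₀ hl]
          rcases le_or_gt k (N.depth (N.su j)) with hk | hk
          · rw [state_some_of_le F Q t₀ hk]
            refine le_trans ?_ (hfifo k _ hk)
            set p := N.state F Q t₀ (N.su j) (N.depth (N.su j))
            -- What has arrived by the service date has left by `p.1`, so the service date precedes
            -- the last FIFO date.
            have h1 : N.arr F j (N.serviceDate F j p.1) ≤ N.linkPos F Q j p.1 p.2 :=
              (le_self_add.trans (hserv p.1).2).trans (reached_linkPos hF j p.1 p.2).1
            exact ⟨le_latest (hserv p.1).1 h1, h1⟩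
          · rw [state_some_of_lt F Q t₀ hk]
      · rintro _ ⟨⟩ k
        rcases le_or_gt k (N.depth (N.su j)) with hk | hk
        · rw [state_some_of_le F Q t₀ hk]
          exact (reached_linkPos hF j _ _).latest hA (hF.dep_le_arr j)
        · rw [state_some_of_lt F Q t₀ hk]
          exact Reached.apply hA.mono _

theorem state_antitone (hF : N.Admissible F) (hQ : N.IsDataOrder F Q)
    (hshaper : ∀ j t, N.serviceCurve j t ≤ N.shapingCurve j t) (t₀ : ℝ≥0) (v : Option S) :
    Antitone (N.state F Q t₀ v) := (state_invariant hF hQ hshaper t₀ v).1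

theorem reached_state (hF : N.Admissible F) (hQ : N.IsDataOrder F Q)
    (hshaper : ∀ j t, N.serviceCurve j t ≤ N.shapingCurve j t) (t₀ : ℝ≥0) (j : S) (k : ℕ) :
    Reached (N.arr F j) (N.state F Q t₀ (some j) k).1 (N.state F Q t₀ (some j) k).2 :=
  (state_invariant hF hQ hshaper t₀ (some j)).2 j rfl k

theorem reached_dep_state (hF : N.Admissible F) (t₀ : ℝ≥0) {j : S} {k : ℕ}
    (hk : k ≤ N.depth (N.su j)) :
    Reached (N.dep F j) (N.state F Q t₀ (N.su j) k).1 (N.state F Q t₀ (some j) k).2 := by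
  rw [state_some_of_le F Q t₀ hk]
  exact reached_linkPos hF j _ _

theorem state_some_fst_of_le (t₀ : ℝ≥0) {j : S} {k : ℕ} (hk : k ≤ N.depth (N.su j)) :
    (N.state F Q t₀ (some j) k).1 =
      latest (N.arr F j) (N.state F Q t₀ (N.su j) k).1 (N.state F Q t₀ (some j) k).2 := by
  rw [state_some_of_le F Q t₀ hk]
  rfl

theorem apply_state_link (hF : N.Admissible F) (hQ : N.IsDataOrder F Q)
    (hshaper : ∀ j t, N.serviceCurve j t ≤ N.shapingCurve j t) (t₀ : ℝ≥0) {j h : S}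
    (hsu : N.su j = some h) {k : ℕ} (hk : k ≤ N.depth (N.su j)) {i : ι} (hij : i ∈ N.Fl j)
    (hih : i ∈ N.Fl h) :
    Q j i (N.state F Q t₀ (some j) k).2 = Q h i (N.state F Q t₀ (some h) k).2 := by
  rw [state_some_of_le F Q t₀ hk, hsu]
  exact (apply_linkPos hF hQ hsu (reached_state hF hQ hshaper t₀ h k) hij hih).symm

/-- Between a date and the position it is attached to, the data order bounds each flow. -/
theorem reached_flow (hQ : N.IsDataOrder F Q) {j : S} {i : ι} (hi : i ∈ N.Fl j) {t x : ℝ≥0}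
    (h : Reached (N.arr F j) t x) : Reached (F i (some j)) t (Q j i x) := by
  refine ⟨?_, fun s hs => ?_⟩
  · rw [← hQ.arrives j i hi]; exact hQ.mono j i hi _ _ h.1 h.exists_le
  · rw [← hQ.arrives j i hi]; exact hQ.mono j i hi _ _ (h.2 s hs) ⟨s, le_rfl⟩

/-! ### The point of the linear program attached to a trajectory -/

variable (N) in
/-- The values of the variables of the linear program for a trajectory observed at date `t₀`. -/
noncomputable def lpPoint (F : N.Trajectory) (Q : S → ι → ℝ≥0 → ℝ≥0) (t₀ : ℝ≥0) : N.LPVar where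
  t v k := (N.state F Q t₀ v k).1
  X i v k := match v with
    | none => Q (N.last i) i (N.state F Q t₀ (some (N.last i)) k).2
    | some h =>
      if h ∈ N.path i then Q h i (N.state F Q t₀ (some h) k).2
      else Q (N.last i) i (N.state F Q t₀ (some (N.last i)) k).2

theorem lpPoint_X_some (t₀ : ℝ≥0) {i : ι} {j : S} (hi : i ∈ N.Fl j) (k : ℕ) :
    (N.lpPoint F Q t₀).X i (some j) k = Q j i (N.state F Q t₀ (some j) k).2 := by
  simp [lpPoint, N.mem_Fl.1 hi]

theorem lpPoint_X_su (hF : N.Admissible F) (hQ : N.IsDataOrder F Q)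
    (hshaper : ∀ j t, N.serviceCurve j t ≤ N.shapingCurve j t) (t₀ : ℝ≥0) {i : ι} {j : S}
    (hi : i ∈ N.Fl j) {k : ℕ} (hk : k ≤ N.depth (N.su j)) :
    (N.lpPoint F Q t₀).X i (N.su j) k = Q j i (N.state F Q t₀ (some j) k).2 := by
  -- Successors are unique, so a flow crossing `j` but not `su j` ends at `j`; there `lpPoint` reads
  -- the share at the last server.
  have hlast : ∀ h, N.su j = some h → i ∉ N.Fl h → j = N.last i := fun h hsu hh => by
    by_contra hne
    obtain ⟨h', hm, hsu'⟩ := N.exists_su_of_ne_last (N.mem_Fl.1 hi) hne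
    obtain rfl : h = h' := Option.some.inj (hsu.symm.trans hsu')
    exact hh (N.mem_Fl.2 hm)
  cases hsu : N.su j with
  | none =>
    have : j = N.last i := by
      by_contra hne
      obtain ⟨h', hm, hsu'⟩ := N.exists_su_of_ne_last (N.mem_Fl.1 hi) hne
      simp [hsu] at hsu'
    simp [lpPoint, this]
  | some h =>
    by_cases hih : i ∈ N.Fl h
    · rw [lpPoint_X_some t₀ hih, apply_state_link hF hQ hshaper t₀ hsu hk hi hih]
    · simp [lpPoint, mt N.mem_Fl.2 hih, ← hlast h hsu hih]

/-- Constraints on aggregates become inequalities between positions. -/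
theorem sum_lpPoint_X_some (hF : N.Admissible F) (hQ : N.IsDataOrder F Q)
    (hshaper : ∀ j t, N.serviceCurve j t ≤ N.shapingCurve j t) (t₀ : ℝ≥0) (j : S) (k : ℕ) :
    ∑ i ∈ N.Fl j, (N.lpPoint F Q t₀).X i (some j) k = (N.state F Q t₀ (some j) k).2 := by
  rw [← hQ.total j _ (reached_state hF hQ hshaper t₀ j k).exists_le, NNReal.coe_sum]
  exact Finset.sum_congr rfl fun i hi => lpPoint_X_some t₀ hi k

theorem sum_lpPoint_X_su (hF : N.Admissible F) (hQ : N.IsDataOrder F Q)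
    (hshaper : ∀ j t, N.serviceCurve j t ≤ N.shapingCurve j t) (t₀ : ℝ≥0) {j : S} {k : ℕ}
    (hk : k ≤ N.depth (N.su j)) :
    ∑ i ∈ N.Fl j, (N.lpPoint F Q t₀).X i (N.su j) k = (N.state F Q t₀ (some j) k).2 := by
  rw [← sum_lpPoint_X_some hF hQ hshaper t₀ j k]
  exact Finset.sum_congr rfl fun i hi => by
    rw [lpPoint_X_some t₀ hi, lpPoint_X_su hF hQ hshaper t₀ hi hk]

theorem constrained_first (hF : N.Admissible F) (i : ι) :
    Constrained (F i (some (N.first i))) (tokenBucket (N.b i) (N.r i)) := hF.arrival i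

theorem baseFeasible_lpPoint (hF : N.Admissible F) (hQ : N.IsDataOrder F Q)
    (hshaper : ∀ j t, N.serviceCurve j t ≤ N.shapingCurve j t) (t₀ : ℝ≥0) :
    N.BaseFeasible (N.lpPoint F Q t₀) := by
  have hfirst : ∀ i, i ∈ N.Fl (N.first i) := fun i => N.mem_Fl.2 (N.first_mem i)
  have hserv : ∀ j, N.state F Q t₀ (some j) (N.depth (some j)) =
      (N.serviceDate F j (N.state F Q t₀ (N.su j) (N.depth (N.su j))).1,
        N.arr F j (N.serviceDate F j (N.state F Q t₀ (N.su j) (N.depth (N.su j))).1)) := fun j =>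
    state_some_of_lt F Q t₀ (N.depth_su_lt j)
  have hsum : ∀ j, N.arr F j (N.state F Q t₀ (some j) (N.depth (some j))).1 +
      N.R j * ((N.state F Q t₀ (N.su j) (N.depth (N.su j))).1 -
        (N.state F Q t₀ (some j) (N.depth (some j))).1 - N.T j) ≤
      (N.state F Q t₀ (some j) (N.depth (N.su j))).2 := fun j => by
    rw [hserv]
    exact (serviceDate_spec hF hshaper j _).2.trans (reached_dep_state hF t₀ le_rfl).1
  have hpos : ∀ j, (N.state F Q t₀ (some j) (N.depth (some j))).2 =
      N.arr F j (N.state F Q t₀ (some j) (N.depth (some j))).1 := fun j => by rw [hserv]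
  refine ⟨?_, ?_, ?_, ?_, ?_, ?_, ?_⟩
  · intro j k _
    exact_mod_cast (state_antitone hF hQ hshaper t₀ (some j) k.le_succ).1
  · intro j k hk
    change ((N.state F Q t₀ (some j) k).1 : ℝ) ≤ (N.state F Q t₀ (N.su j) k).1
    rw [state_some_fst_of_le t₀ hk]
    exact_mod_cast latest_le (hF.isCumulative_arr j).zero
  · intro j i hi k hk
    rw [lpPoint_X_some t₀ hi, lpPoint_X_su hF hQ hshaper t₀ hi hk]
  · intro j
    rw [sum_lpPoint_X_some hF hQ hshaper, sum_lpPoint_X_su hF hQ hshaper t₀ le_rfl, hpos]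
    exact_mod_cast le_self_add.trans (hsum j)
  · intro j
    rw [sum_lpPoint_X_some hF hQ hshaper, sum_lpPoint_X_su hF hQ hshaper t₀ le_rfl, hpos]
    have h := hsum j
    rw [← NNReal.coe_le_coe] at h
    push_cast at h
    refine le_trans ?_ h
    have h3 : ∀ a b c : ℝ≥0, (a : ℝ) - b - c ≤ ((a - b - c : ℝ≥0) : ℝ) := fun a b c => by
      rw [NNReal.coe_sub_def, NNReal.coe_sub_def]
      exact (sub_le_sub_right (le_max_left _ _) _).trans (le_max_left _ _)
    have h4 := mul_le_mul_of_nonneg_left (h3 (N.state F Q t₀ (N.su j) (N.depth (N.su j))).1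
      (N.state F Q t₀ (some j) (N.depth (some j))).1 (N.T j)) (N.R j).coe_nonneg
    change _ + _ * (((N.state F Q t₀ (N.su j) (N.depth (N.su j))).1 : ℝ) -
      (N.state F Q t₀ (some j) (N.depth (some j))).1) - _ ≤ _
    linarith
  · intro i u v huv _
    rw [lpPoint_X_some t₀ (hfirst i), lpPoint_X_some t₀ (hfirst i)]
    have hu := reached_flow hQ (hfirst i) (reached_state hF hQ hshaper t₀ (N.first i) u)
    have hv := reached_flow hQ (hfirst i) (reached_state hF hQ hshaper t₀ (N.first i) v)
    have h := (constrained_first hF i).le_add_real_of_forall_gt ENNReal.coe_ne_top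
      (state_antitone hF hQ hshaper t₀ (some (N.first i)) huv.le).1 hu.2
    have h' := NNReal.coe_le_coe.2 hv.1
    simp only [ENNReal.coe_toReal] at h
    change _ ≤ _ + _ * (((N.state F Q t₀ (some (N.first i)) u).1 : ℝ) -
      (N.state F Q t₀ (some (N.first i)) v).1)
    linarith
  · intro i k _
    rw [lpPoint_X_some t₀ (hfirst i), lpPoint_X_some t₀ (hfirst i)]
    exact_mod_cast hQ.mono _ i (hfirst i) _ _
      (state_antitone hF hQ hshaper t₀ (some (N.first i)) k.le_succ).2
      (reached_state hF hQ hshaper t₀ _ k).exists_le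

theorem shaping_lpPoint (hF : N.Admissible F) (hQ : N.IsDataOrder F Q)
    (hshaper : ∀ j t, N.serviceCurve j t ≤ N.shapingCurve j t) (t₀ : ℝ≥0) (j : S) {u v : ℕ}
    (huv : u < v) (hv : v ≤ N.depth (N.su j)) :
    ∑ i ∈ N.Fl j, (N.lpPoint F Q t₀).X i (N.su j) u -
        ∑ i ∈ N.Fl j, (N.lpPoint F Q t₀).X i (N.su j) v ≤
      N.L j + N.C j * ((N.lpPoint F Q t₀).t (N.su j) u - (N.lpPoint F Q t₀).t (N.su j) v) := by
  have hu := huv.le.trans hv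
  rw [sum_lpPoint_X_su hF hQ hshaper t₀ hu, sum_lpPoint_X_su hF hQ hshaper t₀ hv]
  have h := (hF.constrained_dep j).le_add_real_of_forall_gt ENNReal.coe_ne_top
    (state_antitone hF hQ hshaper t₀ (N.su j) huv.le).1 (reached_dep_state (Q := Q) hF t₀ hu).2
  have h' := NNReal.coe_le_coe.2 (reached_dep_state (Q := Q) hF t₀ hv).1
  simp only [ENNReal.coe_toReal] at h
  change _ ≤ _ + _ * (((N.state F Q t₀ (N.su j) u).1 : ℝ) - (N.state F Q t₀ (N.su j) v).1)
  linarith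

end TreeNetwork

namespace TreeNetwork

open NetCalc

variable {S ι : Type*} {N : TreeNetwork S ι} [DecidableEq S] [Fintype ι]
  {F : N.Trajectory} {Q : S → ι → ℝ≥0 → ℝ≥0}

/-! ### TFA++ -/

/-- The delay of the aggregate traffic of a server is at most the horizontal distance between an
arrival curve and the service curve. -/
theorem sub_latest_le_maxDelay (hF : N.Admissible F)
    (hshaper : ∀ j t, N.serviceCurve j t ≤ N.shapingCurve j t) {j : S} {α : ℝ≥0 → ℝ≥0∞}
    (hα : Constrained (N.arr F j) α) {t y : ℝ≥0} (hy : N.dep F j t ≤ y) :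
    ((t - latest (N.arr F j) t y : ℝ≥0) : ℝ≥0∞) ≤ maxDelay α (N.serviceCurve j) := by
  -- Every `d` strictly below the delay is a witness for the horizontal distance.
  refine ENNReal.le_of_forall_nnreal_lt fun d hd => ?_
  have hd' : d < t - latest (N.arr F j) t y := by exact_mod_cast hd
  have hdt : d ≤ t := hd'.le.trans tsub_le_self
  have hs : latest (N.arr F j) t y < t - d := by
    rw [lt_tsub_iff_left] at hd' ⊢
    rwa [add_comm]
  obtain ⟨u, hut, hu⟩ := hF.exists_service hshaper j t
  have hus : u ≤ t - d :=
    (le_latest hut ((le_self_add.trans hu).trans hy)).trans hs.le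
  have hlt := lt_of_latest_lt hs tsub_le_self
  -- Arrivals on `[u, t - d]` exceed the service `β_j (t - u)`, and `t - u` is the length of this
  -- interval plus `d`.
  refine le_iSup₂_of_le (t - d - u) d (le_iSup_of_le ?_ le_rfl)
  have htu : t - d - u + d = t - u := by
    rw [tsub_right_comm, tsub_add_cancel_of_le]
    rw [le_tsub_iff_right hut, add_comm]
    exact (le_tsub_iff_right hdt).1 hus
  rw [htu]
  have h1 : (N.arr F j u : ℝ≥0∞) + N.serviceCurve j (t - u) < N.arr F j (t - d) := by
    unfold serviceCurve rateLatency
    exact_mod_cast (hu.trans hy).trans_lt hlt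
  exact lt_of_add_lt_add_left (h1.trans_le (hα _ _ hus))

theorem apply_latest_le_dep (hF : N.Admissible F) (hQ : N.IsDataOrder F Q) {j : S} {i : ι}
    (hi : i ∈ N.Fl j) (t : ℝ≥0) :
    F i (some j) (latest (N.arr F j) t (N.dep F j t)) ≤ F i (N.su j) t := by
  rw [← hQ.arrives j i hi, ← hQ.served j i hi]
  exact hQ.mono j i hi _ _ (hF.isCumulative_arr j).apply_latest_le ⟨t, hF.dep_le_arr j t⟩

/-- A flow that crosses a FIFO server of delay at most `d` has its burst increased by `r d`. -/
theorem constrained_out_of_delay (hF : N.Admissible F) (hQ : N.IsDataOrder F Q) {j : S} {i : ι}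
    (hi : i ∈ N.Fl j) {c d : ℝ≥0∞} {r : ℝ≥0}
    (hc : Constrained (F i (some j)) (tokenBucket c r))
    (hd : ∀ t, ((t - latest (N.arr F j) t (N.dep F j t) : ℝ≥0) : ℝ≥0∞) ≤ d) :
    Constrained (F i (N.su j)) (tokenBucket (c + r * d) r) := by
  refine constrained_of_lt fun s t hst => ?_
  have hA := hF.isCumulative_arr j
  -- The output at `s` contains the input up to `τ`, so its increase on `[s, t]` is at most the
  -- increase of the input on `[τ, t]`, with `s - τ ≤ d`.
  set τ := latest (N.arr F j) s (N.dep F j s)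
  have hτs : τ ≤ s := latest_le hA.zero
  have h1 : F i (some j) τ ≤ F i (N.su j) s := apply_latest_le_dep hF hQ hi s
  have hsplit : ((t - τ : ℝ≥0) : ℝ≥0∞) = (t - s : ℝ≥0) + (s - τ : ℝ≥0) := by
    norm_cast
    rw [tsub_add_tsub_cancel hst.le hτs]
  calc (F i (N.su j) t : ℝ≥0∞) ≤ F i (some j) t := by
        exact_mod_cast hF.causal i j (N.mem_Fl.1 hi) t
    _ ≤ F i (some j) τ + (c + r * (t - τ : ℝ≥0)) := hc.le_add (hτs.trans hst.le)
    _ ≤ F i (N.su j) s + (c + r * ((t - s : ℝ≥0) + d)) := by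
        rw [hsplit]
        gcongr
        exact hd s
    _ = _ := by ring

variable [Fintype S]

/-- Each flow starts at `j` or comes from a predecessor `h` on its path. The shaper of `h` bounds
all of `Fl(h)`, including the flows that stop there, hence also those going on to `j`. -/
theorem constrained_arr (hF : N.Admissible F) {j : S} {c : ι → ℝ≥0∞}
    (hc : ∀ i ∈ N.Fl j, Constrained (F i (some j)) (tokenBucket (c i) (N.r i))) :
    Constrained (N.arr F j) fun t =>
      (∑ h ∈ Finset.univ.filter (fun h => N.su h = some j),
        min (N.shapingCurve h t)
          (∑ i ∈ Finset.univ.filter (fun i => h ∈ N.path i ∧ j ∈ N.path i),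
            tokenBucket (c i) (N.r i) t))
      + ∑ i ∈ Finset.univ.filter (fun i => N.first i = j), N.arrivalCurve i t := by
  intro s t hst
  set g : ι → ℝ≥0 := fun i => F i (some j) t - F i (some j) s with hg
  have hcover : ∑ i ∈ N.Fl j, g i ≤
      (∑ h ∈ Finset.univ.filter (fun h => N.su h = some j),
        ∑ i ∈ Finset.univ.filter (fun i => h ∈ N.path i ∧ j ∈ N.path i), g i) +
      ∑ i ∈ Finset.univ.filter (fun i => N.first i = j), g i := by
    simp only [Finset.sum_filter (s := (Finset.univ : Finset ι))]
    rw [Finset.sum_comm, ← Finset.sum_add_distrib]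
    refine (Finset.sum_le_sum fun i hi => ?_).trans
      (Finset.sum_le_sum_of_subset (Finset.subset_univ _))
    have hj := N.mem_Fl.1 hi
    by_cases hfirst : j = N.first i
    · rw [if_pos hfirst.symm]; exact le_add_self
    · obtain ⟨p, hp, hsu⟩ := N.exists_pred_of_ne_first hj hfirst
      refine le_trans ?_ le_self_add
      refine le_trans ?_ (Finset.single_le_sum (fun _ _ => zero_le)
        (show p ∈ Finset.univ.filter (fun h => N.su h = some j) by simp [hsu]))
      rw [if_pos ⟨hp, hj⟩]
  have hgle : ∀ i, ∀ β : ℝ≥0 → ℝ≥0∞, Constrained (F i (some j)) β → (g i : ℝ≥0∞) ≤ β (t - s) := by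
    intro i β hβ
    rw [hg, ENNReal.coe_sub, tsub_le_iff_left]
    exact hβ s t hst
  have hadd : N.arr F j t = N.arr F j s + ∑ i ∈ N.Fl j, g i := by
    unfold arr
    rw [← Finset.sum_add_distrib]
    exact Finset.sum_congr rfl fun i hi =>
      (add_tsub_cancel_of_le ((hF.cumul_in i j (N.mem_Fl.1 hi)).mono hst)).symm
  have hshape : ∀ h, N.su h = some j → ((∑ i ∈ N.Fl h, g i : ℝ≥0) : ℝ≥0∞) ≤
      N.shapingCurve h (t - s) := by
    intro h hsu
    have h1 := hF.constrained_dep h s t hst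
    have h2 : N.dep F h t = N.dep F h s + ∑ i ∈ N.Fl h, g i := by
      unfold dep
      rw [← Finset.sum_add_distrib, hsu]
      refine Finset.sum_congr rfl fun i hi => (add_tsub_cancel_of_le ?_).symm
      have := (hF.cumul_out i h (N.mem_Fl.1 hi)).mono hst
      rwa [hsu] at this
    rw [h2, ENNReal.coe_add] at h1
    exact (ENNReal.add_le_add_iff_left ENNReal.coe_ne_top).1 h1
  rw [hadd, ENNReal.coe_add]
  gcongr
  refine (ENNReal.coe_le_coe.2 hcover).trans ?_
  rw [ENNReal.coe_add]
  simp only [ENNReal.ofNNReal_finsetSum]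
  refine add_le_add (Finset.sum_le_sum fun h hh => le_min ?_ ?_) (Finset.sum_le_sum fun i hi => ?_)
  · refine le_trans ?_ (hshape h (Finset.mem_filter.1 hh).2)
    rw [ENNReal.ofNNReal_finsetSum]
    exact Finset.sum_le_sum_of_subset fun i hi =>
      N.mem_Fl.2 (Finset.mem_filter.1 hi).2.1
  · exact Finset.sum_le_sum fun i hi =>
      hgle i _ (hc i (N.mem_Fl.2 (Finset.mem_filter.1 hi).2.2))
  · obtain rfl := (Finset.mem_filter.1 hi).2
    exact hgle i _ (hF.arrival i)

theorem constrained_tfaBurst (hF : N.Admissible F) (hQ : N.IsDataOrder F Q)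
    (hshaper : ∀ j t, N.serviceCurve j t ≤ N.shapingCurve j t) (j : S) :
    ∀ i ∈ N.Fl j, Constrained (F i (some j)) (tokenBucket (N.tfaBurst j i) (N.r i)) := by
  induction hn : N.rank j using Nat.strong_induction_on generalizing j with
  | _ n ih =>
    intro i hi
    rw [tfaBurst]
    split
    · next hprev =>
      rw [N.eq_first_of_prev_eq_none (N.mem_Fl.1 hi) hprev]
      exact hF.arrival i
    · next p hprev =>
      have hsu := N.su_of_prev hprev
      have hp := N.mem_Fl.2 (N.prev_mem hprev)
      have hburst := ih _ (hn ▸ N.rank_lt hsu) p rfl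
      rw [← hsu]
      exact constrained_out_of_delay hF hQ hp (hburst i hp) fun t =>
        sub_latest_le_maxDelay hF hshaper (constrained_arr hF hburst) le_rfl

theorem tfa_lpPoint (hF : N.Admissible F) (hQ : N.IsDataOrder F Q)
    (hshaper : ∀ j t, N.serviceCurve j t ≤ N.shapingCurve j t) (t₀ : ℝ≥0) (j : S) {k : ℕ}
    (hk : k ≤ N.depth (N.su j)) :
    ENNReal.ofReal ((N.lpPoint F Q t₀).t (N.su j) k - (N.lpPoint F Q t₀).t (some j) k) ≤
      N.tfaDelay j := by
  change ENNReal.ofReal (((N.state F Q t₀ (N.su j) k).1 : ℝ) - (N.state F Q t₀ (some j) k).1) ≤ _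
  rw [ENNReal.ofReal, ← NNReal.sub_def, state_some_fst_of_le t₀ hk]
  exact sub_latest_le_maxDelay hF hshaper
    (constrained_arr hF (constrained_tfaBurst hF hQ hshaper j)) (reached_dep_state hF t₀ hk).1

end TreeNetwork

namespace TreeNetwork

open NetCalc

variable {S ι : Type*} {N : TreeNetwork S ι} [DecidableEq S] [Fintype ι] [DecidableEq ι]
  {F : N.Trajectory} {Q : S → ι → ℝ≥0 → ℝ≥0}

/-! ### SFA -/

theorem rate_le_sfaRate (hstable : ∀ j, ∑ i ∈ N.Fl j, N.r i ≤ N.R j) {i : ι} {j : S}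
    (hi : i ∈ N.Fl j) : N.r i ≤ N.sfaRate i j := by
  unfold sfaRate
  refine le_tsub_of_add_le_right ?_
  rw [Finset.add_sum_erase _ _ hi]
  exact hstable j

theorem coe_sfaRate (hstable : ∀ j, ∑ i ∈ N.Fl j, N.r i ≤ N.R j) (i : ι) (j : S) :
    (N.sfaRate i j : ℝ) = N.R j - ∑ k ∈ (N.Fl j).erase i, (N.r k : ℝ) := by
  unfold sfaRate
  rw [NNReal.coe_sub, NNReal.coe_sum]
  exact (Finset.sum_le_sum_of_subset (Finset.erase_subset _ _)).trans (hstable j)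

theorem burst_ne_top_of_sfaStep_ne_top {i : ι} {j : S} {c : ι → ℝ≥0∞}
    (h : N.sfaStep j i c ≠ ⊤) : ∀ k ∈ (N.Fl j).erase i, c k ≠ ⊤ := by
  intro k hk hck
  refine h ?_
  have : ∑ k ∈ (N.Fl j).erase i, c k = ⊤ := ENNReal.sum_eq_top.2 ⟨k, hk, hck⟩
  simp [sfaStep, this, ENNReal.top_div]

theorem burst_eq_zero_of_sfaStep_ne_top {i : ι} {j : S} {c : ι → ℝ≥0∞}
    (h : N.sfaStep j i c ≠ ⊤) (hR : N.R j = 0) : ∀ k ∈ (N.Fl j).erase i, c k = 0 := by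
  refine Finset.sum_eq_zero_iff.1 ?_
  by_contra hne
  refine h ?_
  rw [sfaStep, hR, ENNReal.coe_zero, ENNReal.div_zero hne, add_top]

/-- The product form also covers `R j = 0`, where a finite latency forces the cross bursts to
vanish. -/
theorem rate_mul_sfaStep {i : ι} {j : S} {c : ι → ℝ≥0∞} (h : N.sfaStep j i c ≠ ⊤) :
    N.R j * (N.sfaStep j i c).toReal =
      N.R j * N.T j + ∑ k ∈ (N.Fl j).erase i, (c k).toReal := by
  have hc := burst_ne_top_of_sfaStep_ne_top h
  have hdiv : (∑ k ∈ (N.Fl j).erase i, c k) / N.R j ≠ ⊤ := fun h' => h (by simp [sfaStep, h'])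
  rcases eq_or_ne (N.R j) 0 with hR | hR
  · have h0 := burst_eq_zero_of_sfaStep_ne_top h hR
    rw [Finset.sum_eq_zero fun k hk => by rw [h0 k hk, ENNReal.toReal_zero]]
    simp [hR]
  · rw [sfaStep, ENNReal.toReal_add ENNReal.coe_ne_top hdiv, ENNReal.toReal_div,
      ENNReal.toReal_sum hc, mul_add, ENNReal.coe_toReal, ENNReal.coe_toReal,
      mul_div_cancel₀ _ (by exact_mod_cast hR)]

/-- The residual service of flow `i` at a FIFO server. -/
theorem exists_residual_service (hF : N.Admissible F) (hQ : N.IsDataOrder F Q)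
    (hshaper : ∀ j t, N.serviceCurve j t ≤ N.shapingCurve j t)
    (hstable : ∀ j, ∑ i ∈ N.Fl j, N.r i ≤ N.R j) {j : S} {i : ι} (hi : i ∈ N.Fl j)
    {c : ι → ℝ≥0∞} (hc : ∀ k ∈ N.Fl j, Constrained (F k (some j)) (tokenBucket (c k) (N.r k)))
    (hθ : N.sfaStep j i c ≠ ⊤) {t y : ℝ≥0} (hy : Reached (N.dep F j) t y) :
    ∃ s ≤ latest (N.arr F j) t y,
      (F i (some j) s : ℝ) + N.R j * (t - latest (N.arr F j) t y - (N.sfaStep j i c).toReal)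
        + N.sfaRate i j * (latest (N.arr F j) t y - s) ≤ Q j i y := by
  have hct := burst_ne_top_of_sfaStep_ne_top hθ
  have hr := hy.latest (hF.isCumulative_arr j) (hF.dep_le_arr j)
  obtain ⟨s, hst, hs⟩ := hF.exists_service hshaper j t
  have hs' := hs.trans hy.1
  have hsτ := le_latest hst (le_self_add.trans hs')
  refine ⟨s, hsτ, ?_⟩
  set τ := latest (N.arr F j) t y
  have h1 := hQ.total j y hr.exists_le
  rw [← h1] at hs'
  unfold arr at hs'
  rw [← Finset.add_sum_erase _ _ hi, ← Finset.add_sum_erase (N.Fl j) (fun i => Q j i y) hi,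
    ← NNReal.coe_le_coe] at hs'
  push_cast at hs'
  -- Position `y` is reached at `τ`, so the cross traffic obeys its buckets on `[s, τ]`. Removing it
  -- leaves the residual rate on `[s, τ]` and the full rate on the excess of `t - τ` over the
  -- latency.
  have h2 : ∑ k ∈ (N.Fl j).erase i, (Q j k y : ℝ) ≤
      ∑ k ∈ (N.Fl j).erase i, (F k (some j) s : ℝ) +
        (∑ k ∈ (N.Fl j).erase i, (c k).toReal +
          (∑ k ∈ (N.Fl j).erase i, (N.r k : ℝ)) * (τ - s)) := by
    rw [Finset.sum_mul, ← Finset.sum_add_distrib, ← Finset.sum_add_distrib]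
    exact Finset.sum_le_sum fun k hk =>
      (hc k (Finset.mem_of_mem_erase hk)).le_add_real_of_forall_gt (hct k hk) hsτ
        (reached_flow hQ (Finset.mem_of_mem_erase hk) hr).2
  have h3 : (t : ℝ) - s - N.T j ≤ ((t - s - N.T j : ℝ≥0) : ℝ) := by
    rw [NNReal.coe_sub_def, NNReal.coe_sub hst]; exact le_max_left _ _
  have h4 := mul_le_mul_of_nonneg_left h3 (N.R j).coe_nonneg
  have h5 := rate_mul_sfaStep hθ
  rw [coe_sfaRate hstable]
  linarith

theorem constrained_out_of_residual_service (hF : N.Admissible F) (hQ : N.IsDataOrder F Q)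
    (hshaper : ∀ j t, N.serviceCurve j t ≤ N.shapingCurve j t)
    (hstable : ∀ j, ∑ i ∈ N.Fl j, N.r i ≤ N.R j) {j : S} {i : ι} (hi : i ∈ N.Fl j)
    {c : ι → ℝ≥0∞} (hc : ∀ k ∈ N.Fl j, Constrained (F k (some j)) (tokenBucket (c k) (N.r k))) :
    Constrained (F i (N.su j)) (tokenBucket (c i + N.r i * N.sfaStep j i c) (N.r i)) := by
  have hcausal := hF.causal i j (N.mem_Fl.1 hi)
  by_cases hθ : N.sfaStep j i c = ⊤
  · refine constrained_of_lt fun s t hst => ?_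
    -- Since `0 · ∞ = 0`, a flow of rate zero must keep its burst: it never sends more than `c i` in
    -- total.
    rcases eq_or_ne (N.r i) 0 with hr | hr
    · have h := (hc i hi).le_add (zero_le (a := t))
      rw [(hF.cumul_in i j (N.mem_Fl.1 hi)).zero, hr] at h
      simp only [hr, ENNReal.coe_zero, zero_mul, add_zero, zero_add] at h ⊢
      exact ((ENNReal.coe_le_coe.2 (hcausal t)).trans h).trans le_add_self
    · have : (N.r i : ℝ≥0∞) ≠ 0 := by exact_mod_cast hr
      simp [hθ, ENNReal.mul_top this]
  by_cases hci : c i = ⊤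
  · exact constrained_of_lt fun s t _ => by simp [hci]
  have hrρ := NNReal.coe_le_coe.2 (rate_le_sfaRate hstable hi)
  have hρR : (N.sfaRate i j : ℝ) ≤ N.R j := NNReal.coe_le_coe.2 tsub_le_self
  refine constrained_of_lt fun u v huv => ?_
  have hA := hF.isCumulative_arr j
  have hτu : latest (N.arr F j) u (N.dep F j u) ≤ u := latest_le hA.zero
  have h1 : (F i (N.su j) v : ℝ) ≤ F i (some j) v := NNReal.coe_le_coe.2 (hcausal v)
  have key : (F i (N.su j) v : ℝ) ≤ F i (N.su j) u +
      ((c i).toReal + N.r i * (N.sfaStep j i c).toReal + N.r i * (v - u)) := by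
    -- A delay within the residual latency is handled as for TFA++; beyond it, both rates of the
    -- residual service are at least `r i`.
    rcases le_total ((u : ℝ) - latest (N.arr F j) u (N.dep F j u)) (N.sfaStep j i c).toReal
      with hle | hle
    · have h2 := NNReal.coe_le_coe.2 (apply_latest_le_dep hF hQ hi u)
      have h3 := (hc i hi).le_add_real hci (hτu.trans huv.le)
      have h4 := mul_le_mul_of_nonneg_left hle (N.r i).coe_nonneg
      linarith
    · obtain ⟨s, hs, h2⟩ := exists_residual_service hF hQ hshaper hstable hi hc hθ
        (Reached.apply (hF.isCumulative_dep j).mono u)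
      rw [hQ.served j i hi] at h2
      have h3 := (hc i hi).le_add_real hci ((hs.trans hτu).trans huv.le)
      have h4 := mul_le_mul_of_nonneg_right (hrρ.trans hρR) (sub_nonneg.2 hle)
      have h5 := mul_le_mul_of_nonneg_right hrρ (sub_nonneg.2 (NNReal.coe_le_coe.2 hs))
      linarith
  rw [← ENNReal.coe_toNNReal hθ, ← ENNReal.coe_toNNReal hci]
  norm_cast
  rw [← NNReal.coe_le_coe]
  push_cast [NNReal.coe_sub huv.le]
  exact key

variable [Fintype S]

theorem constrained_sfaBurst (hF : N.Admissible F) (hQ : N.IsDataOrder F Q)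
    (hshaper : ∀ j t, N.serviceCurve j t ≤ N.shapingCurve j t)
    (hstable : ∀ j, ∑ i ∈ N.Fl j, N.r i ≤ N.R j) (j : S) :
    ∀ i ∈ N.Fl j, Constrained (F i (some j)) (tokenBucket (N.sfaBurst j i) (N.r i)) := by
  induction hn : N.rank j using Nat.strong_induction_on generalizing j with
  | _ n ih =>
    intro i hi
    rw [sfaBurst]
    split
    · next hprev =>
      rw [N.eq_first_of_prev_eq_none (N.mem_Fl.1 hi) hprev]
      exact hF.arrival i
    · next p hprev =>
      have hsu := N.su_of_prev hprev
      rw [← hsu]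
      exact constrained_out_of_residual_service hF hQ hshaper hstable
        (N.mem_Fl.2 (N.prev_mem hprev)) (ih _ (hn ▸ N.rank_lt hsu) p rfl)

/-! ### End-to-end delay along the path of a flow -/

omit [DecidableEq S] [Fintype ι] [DecidableEq ι] [Fintype S] in
theorem path_induction {i : ι} {P : Option S → ℝ≥0∞ → Prop} (w : S → ℝ≥0∞)
    (h0 : P (some (N.first i)) 0)
    (hstep : ∀ j ∈ N.path i, ∀ θ, P (some j) θ → P (N.su j) (θ + w j)) :
    P (N.exit i) ((N.path i).map w).sum := by
  have aux : ∀ (l : List S) (j : S) (θ : ℝ≥0∞), (j :: l).IsChain (fun j h => N.su j = some h) →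
      (∀ x ∈ j :: l, x ∈ N.path i) → P (some j) θ →
      P (N.su ((j :: l).getLast (List.cons_ne_nil j l))) (θ + ((j :: l).map w).sum) := by
    intro l
    induction l with
    | nil => intro j θ _ hmem hP; simpa using hstep j (hmem j (by simp)) θ hP
    | cons h l ih =>
      intro j θ hch hmem hP
      rw [List.isChain_cons_cons] at hch
      have h1 := hstep j (hmem j (by simp)) θ hP
      rw [hch.1] at h1
      have h2 := ih h _ hch.2 (fun x hx => hmem x (List.mem_cons_of_mem _ hx)) h1
      rw [List.getLast_cons (List.cons_ne_nil h l), List.map_cons, List.sum_cons, ← add_assoc]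
      exact h2
  have hp : N.path i = N.first i :: (N.path i).tail := (List.cons_head_tail _).symm
  have := aux (N.path i).tail (N.first i) 0 (hp ▸ N.path_chain i) (fun x hx => hp ▸ hx) h0
  simp only [← hp, zero_add] at this
  exact this

-- An index valid at the exit is thus a FIFO index at every server of the path, and `X` is constant
-- along the path at this index.
omit [DecidableEq S] [Fintype ι] [DecidableEq ι] [Fintype S] in
theorem depth_exit_le {i : ι} {j : S} (hj : j ∈ N.path i) :
    N.depth (N.exit i) ≤ N.depth (N.su j) := by
  induction hn : N.depth (N.su j) using Nat.strong_induction_on generalizing j with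
  | _ n ih =>
    by_cases hlast : j = N.last i
    · rw [← hn, hlast, exit]
    · obtain ⟨h, hm, hsu⟩ := N.exists_su_of_ne_last hj hlast
      have hlt : N.depth (N.su h) < n := by
        rw [← hn, hsu]; exact N.depth_su_lt h
      exact (ih _ hlt hm rfl).trans hlt.le

omit [DecidableEq ι] in
theorem apply_state_eq_first (hF : N.Admissible F) (hQ : N.IsDataOrder F Q)
    (hshaper : ∀ j t, N.serviceCurve j t ≤ N.shapingCurve j t) (t₀ : ℝ≥0) {i : ι} {k : ℕ}
    (hk : k ≤ N.depth (N.exit i)) {j : S} (hj : j ∈ N.path i) :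
    Q j i (N.state F Q t₀ (some j) k).2 =
      Q (N.first i) i (N.state F Q t₀ (some (N.first i)) k).2 := by
  induction hn : N.rank j using Nat.strong_induction_on generalizing j with
  | _ n ih =>
    by_cases hfirst : j = N.first i
    · rw [hfirst]
    · obtain ⟨p, hp, hsu⟩ := N.exists_pred_of_ne_first hj hfirst
      rw [← ih _ (hn ▸ N.rank_lt hsu) hp rfl]
      exact (apply_state_link hF hQ hshaper t₀ hsu (hk.trans (depth_exit_le hp))
        (N.mem_Fl.2 hp) (N.mem_Fl.2 hj)).symm

/-- End-to-end residual service of a flow, and the resulting bound on its delay, when the residual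
rates are at least `ρ > 0`. -/
theorem state_exit_le_of_pos (hF : N.Admissible F) (hQ : N.IsDataOrder F Q)
    (hshaper : ∀ j t, N.serviceCurve j t ≤ N.shapingCurve j t)
    (hstable : ∀ j, ∑ i ∈ N.Fl j, N.r i ≤ N.R j) (t₀ : ℝ≥0) {i : ι} {k : ℕ}
    (hk : k ≤ N.depth (N.exit i)) {ρ : ℝ≥0} (hρ : 0 < ρ) (hr : N.r i ≤ ρ)
    (hρle : ∀ j ∈ N.path i, ρ ≤ N.sfaRate i j)
    (hθ : ((N.path i).map (N.sfaLatency i)).sum ≠ ⊤) :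
    ((N.state F Q t₀ (N.exit i) k).1 : ℝ) ≤ (N.state F Q t₀ (some (N.first i)) k).1 +
      ((N.path i).map (N.sfaLatency i)).sum.toReal + N.b i / ρ := by
  have hpos : (0 : ℝ) < ρ := by exact_mod_cast hρ
  have hrR := NNReal.coe_le_coe.2 hr
  -- The first part is a service curve up to `v`. Its date `s` is kept before the date at the first
  -- server, so that the arrival curve applies between the two when the second part is proved.
  refine (path_induction (N := N) (i := i) (N.sfaLatency i) (P := fun v θ => θ ≠ ⊤ →
    (∀ t ≤ (N.state F Q t₀ v k).1, ∃ s ≤ (N.state F Q t₀ (some (N.first i)) k).1,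
      (F i (some (N.first i)) s : ℝ) + ρ * (t - s - θ.toReal) ≤ F i v t) ∧
    ((N.state F Q t₀ v k).1 : ℝ) ≤ (N.state F Q t₀ (some (N.first i)) k).1 + θ.toReal + N.b i / ρ)
    ?_ ?_ hθ).2
  · refine fun _ => ⟨fun t ht => ⟨t, ht, by simp⟩, ?_⟩
    have : (0 : ℝ) ≤ N.b i / ρ := by positivity
    simpa using this
  · intro j hj θ ih hne
    obtain ⟨hθt, hlt⟩ := ENNReal.add_ne_top.1 hne
    obtain ⟨ihc, ihd⟩ := ih hθt
    have hi := N.mem_Fl.2 hj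
    have hburst := constrained_sfaBurst hF hQ hshaper hstable j
    have hA := hF.isCumulative_arr j
    have hkj := hk.trans (depth_exit_le hj)
    have hρj := NNReal.coe_le_coe.2 (hρle j hj)
    have hρR : (N.sfaRate i j : ℝ) ≤ N.R j := NNReal.coe_le_coe.2 tsub_le_self
    have hdate := state_some_fst_of_le (F := F) (Q := Q) t₀ hkj
    have hreach := reached_dep_state (Q := Q) hF t₀ hkj
    have hX := apply_state_eq_first hF hQ hshaper t₀ hk hj
    have hXf := reached_flow hQ (N.mem_Fl.2 (N.first_mem i))
      (reached_state hF hQ hshaper t₀ (N.first i) k)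
    rw [← hX] at hXf
    rw [ENNReal.toReal_add hθt hlt]
    constructor
    · intro t ht
      have hτ : latest (N.arr F j) t (N.dep F j t) ≤ (N.state F Q t₀ (some j) k).1 := by
        rw [hdate]
        exact latest_mono hA.zero ht (((hF.isCumulative_dep j).mono ht).trans hreach.1)
      have hres : ∃ s ≤ latest (N.arr F j) t (N.dep F j t),
          (F i (some j) s : ℝ) + ρ * (t - s - (N.sfaLatency i j).toReal) ≤ F i (N.su j) t := by
        -- Within the latency, the date `τ` itself works: the rate term is non-positive.
        rcases le_total ((t : ℝ) - latest (N.arr F j) t (N.dep F j t))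
          (N.sfaLatency i j).toReal with hle | hle
        · refine ⟨_, le_rfl, ?_⟩
          have h1 := NNReal.coe_le_coe.2 (apply_latest_le_dep hF hQ hi t)
          have h2 := mul_nonneg hpos.le (sub_nonneg.2 hle)
          linarith
        · obtain ⟨s, hs, h⟩ := exists_residual_service hF hQ hshaper hstable hi hburst hlt
            (Reached.apply (hF.isCumulative_dep j).mono t)
          rw [hQ.served j i hi] at h
          refine ⟨s, hs, ?_⟩
          have h2 := mul_le_mul_of_nonneg_right (hρj.trans hρR) (sub_nonneg.2 hle)
          have h3 := mul_le_mul_of_nonneg_right hρj (sub_nonneg.2 (NNReal.coe_le_coe.2 hs))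
          unfold sfaLatency at h2 ⊢
          linarith
      obtain ⟨s, hs, h1⟩ := hres
      obtain ⟨s', hs', h2⟩ := ihc s (hs.trans hτ)
      exact ⟨s', hs', by linarith⟩
    · rcases le_total (((N.state F Q t₀ (N.su j) k).1 : ℝ) - (N.state F Q t₀ (some j) k).1)
        (N.sfaLatency i j).toReal with hle | hle
      · linarith
      · obtain ⟨s, hs, h⟩ := exists_residual_service hF hQ hshaper hstable hi hburst hlt hreach
        rw [← hdate] at hs h
        obtain ⟨s', hs', h2⟩ := ihc s hs
        -- The burst enters only here, at the first server; `r i ≤ ρ` then cancels the dependence on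
        -- `s'`.
        have h3 := (constrained_first hF i).le_add_real_of_forall_gt ENNReal.coe_ne_top hs' hXf.2
        simp only [ENNReal.coe_toReal] at h3
        have h4 := mul_le_mul_of_nonneg_right (hρj.trans hρR) (sub_nonneg.2 hle)
        have h5 := mul_le_mul_of_nonneg_right hρj (sub_nonneg.2 (NNReal.coe_le_coe.2 hs))
        have h6 := mul_le_mul_of_nonneg_right hrR (sub_nonneg.2 (NNReal.coe_le_coe.2 hs'))
        unfold sfaLatency at h4 ⊢
        have h7 : (((N.state F Q t₀ (N.su j) k).1 : ℝ) - (N.state F Q t₀ (some (N.first i)) k).1 -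
            (θ.toReal + (N.sfaStep j i (N.sfaBurst j)).toReal)) ≤ N.b i / ρ := by
          rw [le_div_iff₀ hpos]
          linarith
        linarith

/-- The delay of a flow without data is at most its residual latency. -/
theorem state_exit_le_of_null (hF : N.Admissible F) (hQ : N.IsDataOrder F Q)
    (hshaper : ∀ j t, N.serviceCurve j t ≤ N.shapingCurve j t)
    (hstable : ∀ j, ∑ i ∈ N.Fl j, N.r i ≤ N.R j) (t₀ : ℝ≥0) {i : ι} {k : ℕ}
    (hk : k ≤ N.depth (N.exit i)) (hb : N.b i = 0) (hr : N.r i = 0)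
    (hθ : ((N.path i).map (N.sfaLatency i)).sum ≠ ⊤) :
    ((N.state F Q t₀ (N.exit i) k).1 : ℝ) ≤ (N.state F Q t₀ (some (N.first i)) k).1 +
      ((N.path i).map (N.sfaLatency i)).sum.toReal := by
  refine (path_induction (N := N) (i := i) (N.sfaLatency i) (P := fun v θ =>
    (∀ t, F i v t = 0) ∧ (θ ≠ ⊤ → ((N.state F Q t₀ v k).1 : ℝ) ≤
      (N.state F Q t₀ (some (N.first i)) k).1 + θ.toReal)) ?_ ?_).2 hθ
  · refine ⟨fun t => ?_, by simp⟩
    have h := (constrained_first hF i).le_add (zero_le (a := t))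
    rw [(hF.cumul_in i _ (N.first_mem i)).zero, hb, hr] at h
    simpa using h
  · intro j hj θ ⟨hzero, ih⟩
    refine ⟨fun t => le_antisymm ((hF.causal i j hj t).trans (hzero t).le) zero_le, fun hne => ?_⟩
    obtain ⟨hθt, hlt⟩ := ENNReal.add_ne_top.1 hne
    rw [ENNReal.toReal_add hθt hlt]
    have ihd := ih hθt
    have hi := N.mem_Fl.2 hj
    have hburst := constrained_sfaBurst hF hQ hshaper hstable j
    have hkj := hk.trans (depth_exit_le hj)
    have hdate := state_some_fst_of_le (F := F) (Q := Q) t₀ hkj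
    have hreach := reached_dep_state (Q := Q) hF t₀ hkj
    have hX0 : Q j i (N.state F Q t₀ (some j) k).2 = 0 := by
      have h := (reached_flow hQ hi (reached_state hF hQ hshaper t₀ j k)).2 _
        (lt_add_of_pos_right _ one_pos)
      rw [hzero] at h
      exact le_antisymm h zero_le
    obtain ⟨s, hs, h⟩ := exists_residual_service hF hQ hshaper hstable hi hburst hlt hreach
    rw [← hdate, hX0] at h
    rw [← hdate] at hs
    -- With zero rate, a finite latency and local stability leave no data at all at `j`, so the
    -- latest date is the departure date itself.
    rcases eq_or_ne (N.R j) 0 with hR | hR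
    · have hc0 := burst_eq_zero_of_sfaStep_ne_top hlt hR
      have hr0 : ∀ k ∈ N.Fl j, N.r k = 0 :=
        Finset.sum_eq_zero_iff.1 (le_antisymm ((hstable j).trans hR.le) zero_le)
      have harr : ∀ t, N.arr F j t = 0 := fun t => Finset.sum_eq_zero fun l hl => by
        by_cases hli : l = i
        · rw [hli, hzero]
        · have h := (hburst l hl).le_add (zero_le (a := t))
          rw [(hF.cumul_in l j (N.mem_Fl.1 hl)).zero, hc0 l (Finset.mem_erase.2 ⟨hli, hl⟩),
            hr0 l hl] at h
          simpa using h
      have h1 : (N.state F Q t₀ (N.su j) k).1 ≤ (N.state F Q t₀ (some j) k).1 := by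
        rw [hdate]
        exact le_latest le_rfl ((harr _).le.trans zero_le)
      have h2 := NNReal.coe_le_coe.2 h1
      have h3 : 0 ≤ (N.sfaLatency i j).toReal := ENNReal.toReal_nonneg
      linarith
    · have hRpos : (0 : ℝ) < N.R j := by exact_mod_cast pos_iff_ne_zero.2 hR
      have h1 := mul_nonneg (N.sfaRate i j).coe_nonneg (sub_nonneg.2 (NNReal.coe_le_coe.2 hs))
      have h2 := (F i (some j) s).coe_nonneg
      have h3 : (N.R j : ℝ) * (((N.state F Q t₀ (N.su j) k).1 : ℝ) -
          (N.state F Q t₀ (some j) k).1 - (N.sfaLatency i j).toReal) ≤ N.R j * 0 := by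
        unfold sfaLatency
        push_cast at h
        linarith
      have h4 := le_of_mul_le_mul_left h3 hRpos
      linarith

theorem sfa_lpPoint (hF : N.Admissible F) (hQ : N.IsDataOrder F Q)
    (hshaper : ∀ j t, N.serviceCurve j t ≤ N.shapingCurve j t)
    (hstable : ∀ j, ∑ i ∈ N.Fl j, N.r i ≤ N.R j) (t₀ : ℝ≥0) (i : ι) {k : ℕ}
    (hk : k ≤ N.depth (N.exit i)) :
    ENNReal.ofReal ((N.lpPoint F Q t₀).t (N.exit i) k -
      (N.lpPoint F Q t₀).t (some (N.first i)) k) ≤ N.sfaDelay i := by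
  change ENNReal.ofReal (((N.state F Q t₀ (N.exit i) k).1 : ℝ) -
    (N.state F Q t₀ (some (N.first i)) k).1) ≤ _
  by_cases htop : N.sfaDelay i = ⊤
  · simp [htop]
  rw [ENNReal.ofReal_le_iff_le_toReal htop]
  unfold sfaDelay at htop ⊢
  have hinf : (⨅ j ∈ N.path i, (N.sfaRate i j : ℝ≥0∞)) ≠ ⊤ :=
    ne_top_of_le_ne_top ENNReal.coe_ne_top (iInf₂_le (N.first i) (N.first_mem i))
  have hle : ∀ j ∈ N.path i, (⨅ j ∈ N.path i, (N.sfaRate i j : ℝ≥0∞)) ≤ N.sfaRate i j :=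
    fun j hj => iInf₂_le j hj
  have hr : (N.r i : ℝ≥0∞) ≤ ⨅ j ∈ N.path i, (N.sfaRate i j : ℝ≥0∞) :=
    le_iInf₂ fun j hj => ENNReal.coe_le_coe.2 (rate_le_sfaRate hstable (N.mem_Fl.2 hj))
  generalize (⨅ j ∈ N.path i, (N.sfaRate i j : ℝ≥0∞)) = ρ at htop hinf hle hr ⊢
  lift ρ to ℝ≥0 using hinf
  simp only [ENNReal.coe_le_coe] at hle hr
  obtain ⟨hθ, hdiv⟩ := ENNReal.add_ne_top.1 htop
  rw [ENNReal.toReal_add hθ hdiv, ENNReal.toReal_div, ENNReal.coe_toReal, ENNReal.coe_toReal]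
  -- If the minimal residual rate is zero, finiteness gives `b i = 0` and stability gives `r i = 0`.
  rcases eq_or_ne ρ 0 with hρ | hρ
  · have hb : N.b i = 0 := by
      by_contra hne
      refine hdiv ?_
      rw [hρ, ENNReal.coe_zero, ENNReal.div_zero (by exact_mod_cast hne)]
    have h := state_exit_le_of_null hF hQ hshaper hstable t₀ hk hb
      (le_antisymm (hρ ▸ hr) zero_le) hθ
    rw [hb, NNReal.coe_zero, zero_div]
    linarith
  · have h := state_exit_le_of_pos hF hQ hshaper hstable t₀ hk (pos_iff_ne_zero.2 hρ) hr hle hθ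
    linarith

theorem feasible_lpPoint (hF : N.Admissible F) (hQ : N.IsDataOrder F Q)
    (hshaper : ∀ j t, N.serviceCurve j t ≤ N.shapingCurve j t)
    (hstable : ∀ j, ∑ i ∈ N.Fl j, N.r i ≤ N.R j) (t₀ : ℝ≥0) :
    N.Feasible (N.lpPoint F Q t₀) where
  toBaseFeasible := baseFeasible_lpPoint hF hQ hshaper t₀
  tfa j _ hk := tfa_lpPoint hF hQ hshaper t₀ j hk
  sfa i _ hk := sfa_lpPoint hF hQ hshaper hstable t₀ i hk
  shaping j _ _ huv hv := shaping_lpPoint hF hQ hshaper t₀ j huv hv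

/-! ### The optimal values -/

omit [Fintype ι] [DecidableEq S] [DecidableEq ι] [Fintype S] in
theorem exit_eq_none {i : ι} (hi : N.last i = N.sink) : N.exit i = none := by
  rw [exit, hi]
  exact (N.su_eq_none N.sink).2 rfl

omit [DecidableEq ι] in
/-- At date `t₀`, the flow of interest leaves the network at the position attached to the date
`t₀`. -/
theorem apply_state_first_eq (hF : N.Admissible F) (hQ : N.IsDataOrder F Q)
    (hshaper : ∀ j t, N.serviceCurve j t ≤ N.shapingCurve j t) (t₀ : ℝ≥0) {i : ι}
    (hi : N.last i = N.sink) :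
    Q (N.first i) i (N.state F Q t₀ (some (N.first i)) 0).2 = F i none t₀ := by
  have hsu : N.su (N.last i) = none := exit_eq_none hi
  have hpos : (N.state F Q t₀ (some (N.last i)) 0).2 = N.dep F (N.last i) t₀ := by
    rw [state_some_of_le F Q t₀ (Nat.zero_le _), hsu, state_none]
    -- Every available output position of the sink is linked, so the least one is `0`, which
    -- `linkPos` raises to the departures at `t₀`.
    have h0 : sInf (N.linkSet F Q (N.last i) 0) = 0 :=
      le_antisymm (csInf_le (OrderBot.bddBelow _)
        ⟨⟨0, zero_le⟩, fun h hh => by simp [hsu] at hh⟩) zero_le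
    simp [fifoStep, linkPos, h0]
  rw [← apply_state_eq_first hF hQ hshaper t₀ (Nat.zero_le _) (N.last_mem i), hpos,
    hQ.served _ i (N.mem_Fl.2 (N.last_mem i)), hsu]

-- This point makes both optimal values non-negative, as needed to compare them with suprema in `[0,
-- ∞]`, which are `0` on the empty set.
variable (N) in
theorem feasible_zero : N.Feasible ⟨fun _ _ => 0, fun _ _ _ => 0⟩ where
  time := by simp
  fifo_time := by simp
  fifo := by simp
  service_nonneg := by simp
  service_rate j := by
    have : (0 : ℝ) ≤ N.R j * N.T j := by positivity
    simpa using this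
  arrival := by simp
  monotony := by simp
  tfa := by simp
  sfa := by simp
  shaping := by simp

theorem lpDelay_nonneg (i : ι) : 0 ≤ N.lpDelay i :=
  le_iSup₂_of_le _ N.feasible_zero (by simp)

theorem lpBacklog_nonneg (i : ι) : 0 ≤ N.lpBacklog i :=
  le_iSup₂_of_le ⟨fun _ _ => 0, fun _ _ _ => 0⟩ 0
    (le_iSup_of_le ⟨N.feasible_zero, by simp [BacklogFeasible]⟩ (by simp))

theorem worstDelay_le_lpDelay
    (hshaper : ∀ j t, N.serviceCurve j t ≤ N.shapingCurve j t)
    (hstable : ∀ j, ∑ i ∈ N.Fl j, N.r i ≤ N.R j) {i : ι} (hi : N.last i = N.sink) :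
    (N.worstDelay i : EReal) ≤ N.lpDelay i := by
  rw [← EReal.coe_toENNReal (lpDelay_nonneg i), EReal.coe_ennreal_le_coe_ennreal_iff]
  refine iSup₂_le fun F hF => iSup₂_le fun t d => iSup_le fun ⟨hdt, hlt⟩ => ?_
  obtain ⟨Q, hQ⟩ := hF.fifo
  rw [← EReal.coe_ennreal_le_coe_ennreal_iff, EReal.coe_toENNReal (lpDelay_nonneg i)]
  refine le_iSup₂_of_le _ (feasible_lpPoint hF hQ hshaper hstable t) ?_
  change ((d : ℝ) : EReal) ≤ (((N.state F Q t none 0).1 : ℝ) -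
    (N.state F Q t (some (N.first i)) 0).1 : ℝ)
  rw [state_none, EReal.coe_le_coe_iff]
  have hf := reached_flow hQ (N.mem_Fl.2 (N.first_mem i))
    (reached_state hF hQ hshaper t (N.first i) 0)
  rw [apply_state_first_eq hF hQ hshaper t hi] at hf
  -- The input at the attached date is at most the output at `t`, hence less than the input at `t -
  -- d`.
  have h : (N.state F Q t (some (N.first i)) 0).1 < t - d := by
    by_contra hle
    exact absurd (((hF.cumul_in i _ (N.first_mem i)).mono (not_lt.1 hle)).trans hf.1)
      (not_le.2 hlt)
  have h' := NNReal.coe_lt_coe.2 h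
  rw [NNReal.coe_sub hdt] at h'
  change (d : ℝ) ≤ t - _
  linarith

omit [DecidableEq ι] [Fintype S] in
theorem state_le (hF : N.Admissible F) (hQ : N.IsDataOrder F Q)
    (hshaper : ∀ j t, N.serviceCurve j t ≤ N.shapingCurve j t) (t₀ : ℝ≥0) (v : Option S) (k : ℕ) :
    (N.state F Q t₀ v k).1 ≤ t₀ := by
  refine (state_antitone hF hQ hshaper t₀ v (Nat.zero_le k)).1.trans ?_
  induction hn : N.depth v using Nat.strong_induction_on generalizing v with
  | _ n ih =>
    cases v with
    | none => rw [state_none]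
    | some j =>
      rw [state_some_fst_of_le t₀ (Nat.zero_le _)]
      exact (latest_le (hF.isCumulative_arr j).zero).trans (ih _ (hn ▸ N.depth_su_lt j) _ rfl)

theorem worstBacklog_le_lpBacklog
    (hshaper : ∀ j t, N.serviceCurve j t ≤ N.shapingCurve j t)
    (hstable : ∀ j, ∑ i ∈ N.Fl j, N.r i ≤ N.R j) {i : ι} (hi : N.last i = N.sink) :
    (N.worstBacklog i : EReal) ≤ N.lpBacklog i := by
  rw [← EReal.coe_toENNReal (lpBacklog_nonneg i), EReal.coe_ennreal_le_coe_ennreal_iff]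
  refine iSup₂_le fun F hF => iSup_le fun t => ?_
  obtain ⟨Q, hQ⟩ := hF.fifo
  rw [← EReal.coe_ennreal_le_coe_ennreal_iff, EReal.coe_toENNReal (lpBacklog_nonneg i)]
  -- The subtraction in `backlog` is truncated at zero.
  rcases le_total (F i (some (N.first i)) t) (F i none t) with hle | hle
  · rw [tsub_eq_zero_of_le hle]
    simpa using lpBacklog_nonneg i
  have hfirst := N.mem_Fl.2 (N.first_mem i)
  refine le_iSup₂_of_le (N.lpPoint F Q t) (F i (some (N.first i)) t) (le_iSup_of_le
    ⟨feasible_lpPoint hF hQ hshaper hstable t, fun u _ => ?_⟩ ?_)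
  · rw [lpPoint_X_some t hfirst]
    change _ ≤ _ + _ * (((N.state F Q t none 0).1 : ℝ) -
      (N.state F Q t (some (N.first i)) u).1)
    rw [state_none]
    have h1 := (reached_flow hQ hfirst (reached_state hF hQ hshaper t (N.first i) u)).1
    have h2 := (constrained_first hF i).le_add_real ENNReal.coe_ne_top
      (state_le (Q := Q) hF hQ hshaper t (some (N.first i)) u)
    have h3 := NNReal.coe_le_coe.2 h1
    simp only [ENNReal.coe_toReal] at h2
    linarith
  · have hX : (N.lpPoint F Q t).X i none 0 = F i none t := by
      rw [← apply_state_first_eq hF hQ hshaper t hi,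
        ← apply_state_eq_first hF hQ hshaper t (Nat.zero_le _) (N.last_mem i)]
      rfl
    rw [hX, ← NNReal.coe_sub hle]
    exact le_rfl

end TreeNetwork

theorem mainTheorem2 {S ι : Type*} [Fintype S] [DecidableEq S] [Fintype ι] [DecidableEq ι]
    (N : TreeNetwork S ι)
    (hshaper : ∀ j t, N.serviceCurve j t ≤ N.shapingCurve j t)
    (hstable : ∀ j, ∑ i ∈ N.Fl j, N.r i ≤ N.R j)
    (i : ι) (hi : N.last i = N.sink) :
    (N.worstDelay i : EReal) ≤ N.lpDelay i ∧ (N.worstBacklog i : EReal) ≤ N.lpBacklog i := by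
  exact ⟨TreeNetwork.worstDelay_le_lpDelay hshaper hstable hi,
    TreeNetwork.worstBacklog_le_lpBacklog hshaper hstable hi⟩
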